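/- Let $1<p\le 2$. There is a constant $C_p>0$ depending only on $p$ such that the following holds. Let $E$ be a locally compact separable metric space, $m$ a Radon measure on $E$ with full support, and $(\mathcal E,\mathcal D(\mathcal E))$ a regular Dirichlet form on $L^2(E,m)$ that is pure-jump with a jumping kernel $J(x,dy)$, that is, $J(x,dy)\,m(dx)$ is symmetric off the diagonal and $$\mathcal E(u,v)=\tfrac12\iint_{x\ne y}(u(y)-u(x))(v(y)-v(x))\,J(x,dy)\,m(dx),\qquad u,v\in\mathcal D(\mathcal E)$$ (for quasi-continuous versions of $u,v$; the symmetry makes the integral independent of the versions). Let $(P_t)_{t\ge0}$ be the strongly continuous semigroup of symmetric contractions on $L^2(E,m)$ associated with $\mathcal E$, i.e. $\mathcal D(\mathcal E)=\{u\in L^2(E,m):\lim_{t\to0^+}\frac1t\int_E(u-P_tu)u\,dm\text{ exists and is finite}\}$ and $\mathcal E(u,v)=\lim_{t\to0^+}\frac1t\int_E(u-P_tu)v\,dm$ for $u,v\in\mathcal D(\mathcal E)$; for $f\in L^p(E,m)$ let $P_tf$ be given by the extension of $P_t$ from $L^2\cap L^p$ to $L^p(E,m)$ by continuity. Put $\chi(s,t)=\mathbf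 1_{\{|s|>|t|\}}+\frac12\mathbf 1_{\{|s|=|t|\}}$ and $$\widetilde\Gamma[u](x)=\int_{E\setminus\{x\}}(u(y)-u(x))^2\,\chi(u(x),u(y))\,J(x,dy).$$ Then for every real-valued $f\in L^p(E,m)$ there is a version of $(t,x)\mapsto P_tf(x)$, $t>0$, that is jointly measurable, and for every such version the modified square function $$\widetilde G(x)=\Big(\int_0^\infty\widetilde\Gamma[P_tf](x)\,dt\Big)^{1/2}\in[0,\infty]$$ satisfies $$\|\widetilde G\|_{L^p(E,m)}\le C_p\,\|f\|_{L^p(E,m)}.$$ -/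

import Mathlib

open MeasureTheory ProbabilityTheory Filter Topology Set
open scoped ENNReal NNReal

/-- A (symmetric) Dirichlet form on `L²(E, m)`: a densely defined, symmetric, non-negative
definite, closed bilinear form on which the unit contraction `u ↦ (0 ∨ u) ∧ 1` operates. -/
structure DirichletForm {E : Type*} [MeasurableSpace E] (m : Measure E) where
  /-- the domain of the form -/
  domain : Submodule ℝ (Lp ℝ 2 m)
  /-- the bilinear form -/
  form : domain →ₗ[ℝ] domain →ₗ[ℝ] ℝ
  dense : Dense (domain : Set (Lp ℝ 2 m))
  symm : ∀ u v : domain, form u v = form v u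
  nonneg : ∀ u : domain, 0 ≤ form u u
  /-- closedness: the domain is complete for the norm `(form u u + ‖u‖²) ^ (1/2)` -/
  closed : ∀ u : ℕ → domain,
    (∀ ε > 0, ∃ N, ∀ i ≥ N, ∀ j ≥ N, form (u i - u j) (u i - u j) + ‖u i - u j‖ ^ 2 < ε) →
    ∃ v : domain, Tendsto (fun n => form (u n - v) (u n - v) + ‖u n - v‖ ^ 2) atTop (𝓝 0)
  markov : ∀ (u : domain) (v : Lp ℝ 2 m),
    (v =ᵐ[m] fun x => max 0 (min ((u : Lp ℝ 2 m) x) 1)) →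
    ∃ hv : v ∈ domain, form ⟨v, hv⟩ ⟨v, hv⟩ ≤ form u u

namespace DirichletForm

/-- Regularity: the members of the domain that have a continuous compactly supported version are
dense in the domain for the norm `(form u u + ‖u‖²) ^ (1/2)`, and (these versions) are dense in
`C_c(E)` for the uniform norm. -/
def IsRegular {E : Type*} [MeasurableSpace E] [TopologicalSpace E] {m : Measure E}
    (𝓔 : DirichletForm m) : Prop :=
  (∀ u : 𝓔.domain, ∀ ε > (0 : ℝ), ∃ (v : 𝓔.domain) (ψ : E → ℝ),
    Continuous ψ ∧ HasCompactSupport ψ ∧ (v : Lp ℝ 2 m) =ᵐ[m] ψ ∧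
      𝓔.form (u - v) (u - v) + ‖u - v‖ ^ 2 < ε) ∧
  (∀ φ : E → ℝ, Continuous φ → HasCompactSupport φ → ∀ ε > (0 : ℝ),
    ∃ (v : 𝓔.domain) (ψ : E → ℝ),
      Continuous ψ ∧ HasCompactSupport ψ ∧ (v : Lp ℝ 2 m) =ᵐ[m] ψ ∧ ∀ x, |φ x - ψ x| < ε)

/-- The form is pure-jump with jumping kernel `J`: the jumping measure `J(x, dy) m(dx)` off the
diagonal is symmetric, and the form is
`½ ∬_{x ≠ y} (u(y) - u(x)) (v(y) - v(x)) J(x, dy) m(dx)`, with no local and no killing part.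
By the symmetry, the jumping measure does not charge `N × E` and `E × N` for `m`-null sets `N`,
so the integral does not depend on the versions of `u` and `v`; in particular it is the same for
the quasi-continuous ones. -/
structure IsPureJump {E : Type*} [MeasurableSpace E] {m : Measure E}
    (𝓔 : DirichletForm m) (J : Kernel E E) : Prop where
  symm : ((m ⊗ₘ J).restrict (diagonal E)ᶜ).map Prod.swap = (m ⊗ₘ J).restrict (diagonal E)ᶜ
  integrable : ∀ u v : 𝓔.domain,
    Integrable (fun z : E × E => ((u : Lp ℝ 2 m) z.2 - (u : Lp ℝ 2 m) z.1) *
      ((v : Lp ℝ 2 m) z.2 - (v : Lp ℝ 2 m) z.1)) ((m ⊗ₘ J).restrict (diagonal E)ᶜ)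
  form_eq : ∀ u v : 𝓔.domain,
    𝓔.form u v = 1 / 2 * ∫ z : E × E in (diagonal E)ᶜ,
      ((u : Lp ℝ 2 m) z.2 - (u : Lp ℝ 2 m) z.1) *
        ((v : Lp ℝ 2 m) z.2 - (v : Lp ℝ 2 m) z.1) ∂(m ⊗ₘ J)

/-- `(P t)`, `t ≥ 0`, is the strongly continuous semigroup of symmetric contractions on `L²(E, m)`
associated with the form (the values at `t < 0` are irrelevant). -/
structure IsSemigroup {E : Type*} [MeasurableSpace E] {m : Measure E}
    (𝓔 : DirichletForm m) (P : ℝ → Lp ℝ 2 m →L[ℝ] Lp ℝ 2 m) : Prop where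
  zero : ∀ f, P 0 f = f
  add : ∀ s t : ℝ, 0 ≤ s → 0 ≤ t → ∀ f, P (s + t) f = P s (P t f)
  contraction : ∀ t : ℝ, 0 ≤ t → ∀ f, ‖P t f‖ ≤ ‖f‖
  symm : ∀ t : ℝ, 0 ≤ t → ∀ f g, inner ℝ (P t f) g = inner ℝ f (P t g)
  continuous : ∀ f, Tendsto (fun t => P t f) (𝓝[>] 0) (𝓝 f)
  mem_domain_iff : ∀ u : Lp ℝ 2 m, u ∈ 𝓔.domain ↔
    ∃ l : ℝ, Tendsto (fun t : ℝ => 1 / t * inner ℝ (u - P t u) u) (𝓝[>] 0) (𝓝 l)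
  form_eq : ∀ u v : 𝓔.domain,
    Tendsto (fun t : ℝ => 1 / t * inner ℝ ((u : Lp ℝ 2 m) - P t u) (v : Lp ℝ 2 m))
      (𝓝[>] 0) (𝓝 (𝓔.form u v))

end DirichletForm

/-- `g` is a version of the value at `f ∈ L^p` of the extension by continuity to `L^p(E, m)` of the
operator `S` on `L²(E, m)`: if `hₙ ∈ L² ∩ L^p` and `hₙ → f` in `L^p`, then `S hₙ → g` in `L^p`.
(For `p < ∞` the set `L² ∩ L^p` is dense in `L^p`, so `g` is unique almost everywhere.) -/
def IsLpExtension {E : Type*} [MeasurableSpace E] {m : Measure E}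
    (S : Lp ℝ 2 m →L[ℝ] Lp ℝ 2 m) (p : ℝ≥0∞) (f g : E → ℝ) : Prop :=
  MemLp g p m ∧ ∀ h : ℕ → Lp ℝ 2 m, (∀ n, MemLp (h n) p m) →
    Tendsto (fun n => eLpNorm (fun x => h n x - f x) p m) atTop (𝓝 0) →
    Tendsto (fun n => eLpNorm (fun x => S (h n) x - g x) p m) atTop (𝓝 0)

/-- `u` is a version of `(t, x) ↦ P_t f (x)`, `t > 0`, that is jointly measurable in `(t, x)`, where
`f ∈ L^p` and `(P_t)` is extended from `L²` to `L^p`. -/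
def IsSemigroupVersion {E : Type*} [MeasurableSpace E] {m : Measure E}
    (P : ℝ → Lp ℝ 2 m →L[ℝ] Lp ℝ 2 m) (p : ℝ≥0∞) (f : E → ℝ) (u : ℝ → E → ℝ) : Prop :=
  Measurable (fun z : ℝ × E => u z.1 z.2) ∧ ∀ t : ℝ, 0 < t → IsLpExtension (P t) p f (u t)

/-- The weight `χ(s, t) = 1_{|s| > |t|} + ½ 1_{|s| = |t|}`. -/
noncomputable def chi (s t : ℝ) : ℝ :=
  if |t| < |s| then 1 else if |s| = |t| then 1 / 2 else 0

/-- The modified carré du champ operator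
`Γ̃[u](x) = ∫_{E ∖ {x}} (u(y) - u(x))² χ(u(x), u(y)) J(x, dy)`, with values in `[0, ∞]`. -/
noncomputable def modifiedCarreDuChamp {E : Type*} [MeasurableSpace E] (J : Kernel E E)
    (u : E → ℝ) (x : E) : ℝ≥0∞ :=
  ∫⁻ y in {x}ᶜ, ENNReal.ofReal ((u y - u x) ^ 2 * chi (u x) (u y)) ∂(J x)

/-- The modified square function `G̃(x) = (∫₀^∞ Γ̃[u(t, ·)](x) dt) ^ (1/2)`, with values in
`[0, ∞]`, to be used for `u(t, x) = P_t f (x)`. -/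
noncomputable def modifiedSquareFunction {E : Type*} [MeasurableSpace E] (J : Kernel E E)
    (u : ℝ → E → ℝ) (x : E) : ℝ≥0∞ :=
  (∫⁻ t in Ioi (0 : ℝ), modifiedCarreDuChamp J (u t) x) ^ (1 / 2 : ℝ)

/-! Write `u_t = P_t f` and `r` for the exponent. The weight `chi` keeps only jumps from `x` to
points `y` with `|u y| ≤ |u x|`, and there `(u y - u x)²` is `|u x|^(2 - r)` times the density `(u y
- u x)² max(|u x|, |u y|)^(r - 2)`. Hence `G̃² ≤ (sup_t |u_t|)^(2 - r) · I`, where `I x` is the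
integral of that density over times and jumps. Raising to the power `r / 2` and applying Hölder with
weights `(2 - r) / 2` and `r / 2` leaves two estimates: the maximal theorem in `L^r`, and `∫ I dm ≤
C ‖f‖_r^r`.

The energy estimate comes from differentiating `∫ |u_t|^r`. Formally the derivative is `-r 𝓔(u_t,
|u_t|^(r - 2) u_t)`, and strict convexity of the power bounds the jump integrand of this form below
by `r (r - 1)` times the density (`powDensity_le`). To make this rigorous the power is replaced by
`(a² + ε²)^(r / 2) - ε^r`, whose derivative is Lipschitz, so that its composition with `u_t` stays
in the domain. Only an upper bound on right slopes is proved (`exists_slope_le`); this suffices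
because the functional is antitone in time (`lintegral_le_of_antitoneOn`). Fatou's lemma removes `ε`
and passes from `L² ∩ L^r` to `L^r`.

The maximal theorem follows Rota and Stein. Compressing `P_δ` to step functions gives a symmetric
sub-Markov matrix `Q` with a stationary chain `Y`. Without killing, for `F ≥ 0` and `v_k = Q^(N - k)
F`, the process `v_k(Y_k)` is a martingale, and reversibility identifies `Q^(2j) F (Y_N)` with the
conditional expectation of `v_(N - j)(Y_(N - j))` given `Y_N`; killing is compensated by births and
turns identities into inequalities. Doob's inequality, proved with a Bellman function, bounds all
even powers at once. Refining the partition and the time mesh yields the semigroup.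

Spectral theory is avoided: convexity of `t ↦ ⟪P_t f, f⟫` gives the needed facts on the domain.
Sub-Markovianity follows from the decay of the squared distance to `[0, 1]`, and stability of the
domain under Lipschitz maps from the finite matrix case. -/

/-! ### Midpoint convexity -/

/-- A continuous midpoint convex function on `[0, ∞)` lies below its chords. -/
theorem chord_of_midpoint {g : ℝ → ℝ} (hc : ContinuousOn g (Ici 0))
    (hm : ∀ s t, 0 ≤ s → 0 ≤ t → g ((s + t) / 2) ≤ (g s + g t) / 2)
    {x y c : ℝ} (hx : 0 ≤ x) (hxc : x ≤ c) (hcy : c ≤ y) :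
    (y - x) * g c ≤ (y - c) * g x + (c - x) * g y := by
  set h : ℝ → ℝ := fun z => (y - x) * g z - ((y - z) * g x + (z - x) * g y) with hh
  have hcont : ContinuousOn h (Icc x y) := by
    have : ContinuousOn g (Icc x y) := hc.mono fun z hz => hx.trans hz.1
    fun_prop
  obtain ⟨z1, hz1, hmax⟩ := isCompact_Icc.exists_isMaxOn ⟨c, hxc, hcy⟩ hcont
  by_contra hcon
  have hpos : 0 < h z1 := lt_of_lt_of_le (by simp only [hh]; linarith) (hmax ⟨hxc, hcy⟩)
  -- At the leftmost maximum of the excess `h` over the chord, values to the left are strictly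
  -- smaller; two points symmetric about it then violate the midpoint inequality.
  set S := Icc x y ∩ h ⁻¹' {h z1} with hS
  have hSc : IsClosed S := hcont.preimage_isClosed_of_isClosed isClosed_Icc isClosed_singleton
  have hSn : S.Nonempty := ⟨z1, hz1, rfl⟩
  have hSb : BddBelow S := ⟨x, fun z hz => hz.1.1⟩
  have h0 := hSc.csInf_mem hSn hSb
  set z0 := sInf S with hz0
  have hval : h z0 = h z1 := h0.2
  have hxz : x < z0 := by
    refine lt_of_le_of_ne h0.1.1 fun he => ?_
    rw [← he] at hval
    simp only [hh] at hval hpos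
    nlinarith
  have hzy : z0 < y := by
    refine lt_of_le_of_ne h0.1.2 fun he => ?_
    rw [he] at hval
    simp only [hh] at hval hpos
    nlinarith
  set δ := min (z0 - x) (y - z0) with hδ
  have hδ0 : 0 < δ := lt_min (by linarith) (by linarith)
  have hδ1 : δ ≤ z0 - x := min_le_left _ _
  have hδ2 : δ ≤ y - z0 := min_le_right _ _
  have hl : h (z0 - δ) < h z1 := by
    refine lt_of_le_of_ne (hmax ⟨by linarith, by linarith⟩) fun he => ?_
    have : z0 ≤ z0 - δ := csInf_le hSb ⟨⟨by linarith, by linarith⟩, he⟩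
    linarith
  have hr : h (z0 + δ) ≤ h z1 := hmax ⟨by linarith, by linarith⟩
  have hmid := hm (z0 - δ) (z0 + δ) (by linarith) (by linarith)
  rw [show (z0 - δ + (z0 + δ)) / 2 = z0 by ring] at hmid
  have hyx : 0 < y - x := by linarith
  have := mul_le_mul_of_nonneg_left hmid hyx.le
  simp only [hh] at hval hl hr
  linarith

/-! ### Convex potentials with Lipschitz derivative -/

/-- `φ` is a non-negative convex function with Lipschitz derivative `ψ`, and both vanish at `0`. -/
structure IsConvexPotential (φ ψ : ℝ → ℝ) (L : ℝ≥0) : Prop where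
  lipschitz : LipschitzWith L ψ
  deriv_zero : ψ 0 = 0
  zero : φ 0 = 0
  nonneg : ∀ a, 0 ≤ φ a
  tangent : ∀ a b, φ a + ψ a * (b - a) ≤ φ b

namespace IsConvexPotential

variable {φ ψ : ℝ → ℝ} {L : ℝ≥0}

theorem mul_nonneg (h : IsConvexPotential φ ψ L) (a b : ℝ) : 0 ≤ (b - a) * (ψ b - ψ a) := by
  have h1 := h.tangent a b
  have h2 := h.tangent b a
  nlinarith

theorem abs_deriv_le (h : IsConvexPotential φ ψ L) (a : ℝ) : |ψ a| ≤ L * |a| := by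
  simpa [h.deriv_zero, Real.dist_eq] using h.lipschitz.dist_le_mul a 0

theorem abs_sub_le (h : IsConvexPotential φ ψ L) (a b : ℝ) :
    |φ b - φ a| ≤ L * (|a| + |b|) * |b - a| := by
  have h1 := h.tangent a b
  have h2 := h.tangent b a
  have ha := h.abs_deriv_le a
  have hb := h.abs_deriv_le b
  have e1 : |ψ a * (b - a)| ≤ L * |a| * |b - a| := by
    rw [abs_mul]; gcongr
  have e2 : |ψ b * (a - b)| ≤ L * |b| * |b - a| := by
    rw [abs_mul, abs_sub_comm a b]; gcongr
  have p1 : 0 ≤ L * |a| * |b - a| := by positivity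
  have p2 : 0 ≤ L * |b| * |b - a| := by positivity
  rw [abs_le] at *
  constructor <;> nlinarith

theorem le_sq (h : IsConvexPotential φ ψ L) (a : ℝ) : φ a ≤ L * a ^ 2 := by
  have h1 := (le_abs_self _).trans (h.abs_sub_le 0 a)
  simp only [h.zero, sub_zero, abs_zero, zero_add] at h1
  rwa [mul_assoc, abs_mul_abs_self, ← sq] at h1

theorem continuous (h : IsConvexPotential φ ψ L) : Continuous φ := by
  rw [continuous_iff_continuousAt]
  intro a
  rw [ContinuousAt, tendsto_iff_dist_tendsto_zero]
  refine squeeze_zero (fun _ => dist_nonneg) (fun b => ?_)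
    (g := fun b => L * (|a| + |b|) * |b - a|) ?_
  · rw [Real.dist_eq]; exact h.abs_sub_le a b
  · have : Continuous fun b => L * (|a| + |b|) * |b - a| := by fun_prop
    simpa using this.tendsto a

/-- Half the squared distance to the unit interval. -/
theorem sq_dist_unitInterval :
    IsConvexPotential (fun a => (a - max 0 (min a 1)) ^ 2 / 2) (fun a => a - max 0 (min a 1)) 2 := by
  refine ⟨?_, by simp, by simp, fun a => by positivity, fun a b => ?_⟩
  · rw [lipschitzWith_iff_dist_le_mul]
    intro a b
    simp only [Real.dist_eq, NNReal.coe_ofNat]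
    rcases le_total a 0 with ha | ha <;> rcases le_total a 1 with ha1 | ha1 <;>
    rcases le_total b 0 with hb | hb <;> rcases le_total b 1 with hb1 | hb1 <;>
    simp only [min_eq_left, min_eq_right, max_eq_left, max_eq_right, zero_le_one, ha, ha1, hb, hb1] <;>
    rw [abs_le] <;> constructor <;> cases abs_cases (a - b) <;> linarith
  · rcases le_total a 0 with ha | ha <;> rcases le_total a 1 with ha1 | ha1 <;>
    rcases le_total b 0 with hb | hb <;> rcases le_total b 1 with hb1 | hb1 <;>
    simp only [min_eq_left, min_eq_right, max_eq_left, max_eq_right, zero_le_one, ha, ha1, hb, hb1] <;>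
    nlinarith [sq_nonneg (a - b)]

end IsConvexPotential

/-! ### Regularized powers and the energy density -/

section PowerPotential

/-- A smooth approximation of `|a| ^ r` from below. -/
noncomputable def powPotential (r ε a : ℝ) : ℝ := (a ^ 2 + ε ^ 2) ^ (r / 2) - (ε ^ 2) ^ (r / 2)

/-- The derivative of `powPotential`. -/
noncomputable def powPotentialDeriv (r ε a : ℝ) : ℝ := r * a * (a ^ 2 + ε ^ 2) ^ (r / 2 - 1)

/-- The regularized energy density `(b - a) ^ 2 (max (a ^ 2) (b ^ 2) + ε ^ 2) ^ (r / 2 - 1)`. -/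
noncomputable def powDensity (r ε a b : ℝ) : ℝ :=
  (b - a) ^ 2 * (max (a ^ 2) (b ^ 2) + ε ^ 2) ^ (r / 2 - 1)

variable {r ε : ℝ}

/-- Subadditivity of `s ↦ s ^ (r / 2)`, valid because `r / 2 ≤ 1`. -/
theorem powPotential_le (hr : 1 < r) (hr2 : r ≤ 2) (a : ℝ) : powPotential r ε a ≤ |a| ^ r := by
  have h := NNReal.rpow_add_le_add_rpow (⟨a ^ 2, by positivity⟩ : ℝ≥0) ⟨ε ^ 2, by positivity⟩
    (p := r / 2) (by linarith) (by linarith)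
  have h' : (a ^ 2 + ε ^ 2) ^ (r / 2) ≤ (a ^ 2) ^ (r / 2) + (ε ^ 2) ^ (r / 2) := by exact_mod_cast h
  have : (a ^ 2) ^ (r / 2) = |a| ^ r := by
    rw [← sq_abs, ← Real.rpow_natCast, ← Real.rpow_mul (abs_nonneg a)]
    congr 1; push_cast; ring
  unfold powPotential
  linarith

theorem hasDerivAt_powPotential (hε : 0 < ε) (a : ℝ) :
    HasDerivAt (powPotential r ε) (powPotentialDeriv r ε a) a := by
  have hpos : a ^ 2 + ε ^ 2 ≠ 0 := by positivity
  have h1 : HasDerivAt (fun a : ℝ => a ^ 2 + ε ^ 2) (2 * a) a := by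
    simpa using (hasDerivAt_pow 2 a).add_const (ε ^ 2)
  have h2 := (h1.rpow_const (p := r / 2) (Or.inl hpos)).sub_const ((ε ^ 2) ^ (r / 2))
  refine h2.congr_deriv ?_
  unfold powPotentialDeriv; ring

theorem hasDerivAt_powPotentialDeriv (hε : 0 < ε) (a : ℝ) :
    HasDerivAt (powPotentialDeriv r ε)
      (r * (a ^ 2 + ε ^ 2) ^ (r / 2 - 1) * (1 - (2 - r) * (a ^ 2 / (a ^ 2 + ε ^ 2)))) a := by
  have hp : 0 < a ^ 2 + ε ^ 2 := by positivity
  have h1 : HasDerivAt (fun a : ℝ => a ^ 2 + ε ^ 2) (2 * a) a := by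
    simpa using (hasDerivAt_pow 2 a).add_const (ε ^ 2)
  have h2 := h1.rpow_const (p := r / 2 - 1) (Or.inl hp.ne')
  have h3 := ((hasDerivAt_id a).const_mul r).mul h2
  refine h3.congr_deriv ?_
  rw [Real.rpow_sub_one hp.ne' (r / 2 - 1)]
  simp only [id]
  field_simp
  ring

theorem powPotentialDeriv_deriv_le (hr : 1 < r) (hr2 : r ≤ 2) (hε : 0 < ε) (a : ℝ) :
    r * (a ^ 2 + ε ^ 2) ^ (r / 2 - 1) * (1 - (2 - r) * (a ^ 2 / (a ^ 2 + ε ^ 2)))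
      ≤ r * (ε ^ 2) ^ (r / 2 - 1) := by
  have h1 : (a ^ 2 + ε ^ 2) ^ (r / 2 - 1) ≤ (ε ^ 2) ^ (r / 2 - 1) :=
    Real.rpow_le_rpow_of_nonpos (by positivity) (by nlinarith) (by linarith)
  have h2 : 0 ≤ (2 - r) * (a ^ 2 / (a ^ 2 + ε ^ 2)) := by
    have := sub_nonneg.2 hr2; positivity
  have h3 : 0 ≤ r * (a ^ 2 + ε ^ 2) ^ (r / 2 - 1) := by positivity
  calc _ ≤ r * (a ^ 2 + ε ^ 2) ^ (r / 2 - 1) * 1 := by gcongr; linarith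
    _ ≤ _ := by rw [mul_one]; gcongr

/-- The quotient `a² / (a² + ε²)` is at most one, so the last factor is at least `r - 1`. This is
the source of the constant `r (r - 1)` in the energy estimate. -/
theorem le_powPotentialDeriv_deriv (hr : 1 < r) (hr2 : r ≤ 2) (hε : 0 < ε) (a : ℝ) :
    r * (r - 1) * (a ^ 2 + ε ^ 2) ^ (r / 2 - 1) ≤
      r * (a ^ 2 + ε ^ 2) ^ (r / 2 - 1) * (1 - (2 - r) * (a ^ 2 / (a ^ 2 + ε ^ 2))) := by
  have h2 : a ^ 2 / (a ^ 2 + ε ^ 2) ≤ 1 := by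
    rw [div_le_one (by positivity)]; nlinarith
  have h3 : 0 ≤ r * (a ^ 2 + ε ^ 2) ^ (r / 2 - 1) := by positivity
  calc _ = r * (a ^ 2 + ε ^ 2) ^ (r / 2 - 1) * (r - 1) := by ring
    _ ≤ _ := mul_le_mul_of_nonneg_left
      (by nlinarith [mul_le_mul_of_nonneg_left h2 (sub_nonneg.2 hr2)]) h3

theorem powDensity_nonneg (a b : ℝ) : 0 ≤ powDensity r ε a b := by
  unfold powDensity; positivity

theorem powDensity_comm (a b : ℝ) : powDensity r ε a b = powDensity r ε b a := by
  unfold powDensity; rw [max_comm, ← neg_sub, neg_sq]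

/-- By the mean value theorem the increment is `b - a` times the second derivative at an
intermediate `c`. Since `c² ≤ max (a²) (b²)` and the exponent `r / 2 - 1` is non-positive, replacing
`c²` by the maximum only decreases the lower bound. -/
theorem powDensity_le (hr : 1 < r) (hr2 : r ≤ 2) (hε : 0 < ε) (a b : ℝ) :
    r * (r - 1) * powDensity r ε a b ≤
      (b - a) * (powPotentialDeriv r ε b - powPotentialDeriv r ε a) := by
  wlog hab : a < b generalizing a b
  · rcases eq_or_lt_of_le (not_lt.1 hab) with rfl | h
    · simp [powDensity]
    · rw [powDensity_comm]; linarith [this b a h]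
  obtain ⟨c, hc, hd⟩ := exists_hasDerivAt_eq_slope (powPotentialDeriv r ε) _ hab
    (fun x _ => (hasDerivAt_powPotentialDeriv hε x).continuousAt.continuousWithinAt)
    (fun x _ => hasDerivAt_powPotentialDeriv hε x)
  have hba : 0 < b - a := sub_pos.2 hab
  rw [eq_div_iff hba.ne'] at hd
  rw [← hd]
  have h1 := le_powPotentialDeriv_deriv hr hr2 hε c
  have hcm : c ^ 2 ≤ max (a ^ 2) (b ^ 2) := by
    rcases le_total 0 c with h | h
    · exact le_max_of_le_right (by nlinarith [hc.2])
    · exact le_max_of_le_left (by nlinarith [hc.1])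
  have h2 : (max (a ^ 2) (b ^ 2) + ε ^ 2) ^ (r / 2 - 1) ≤ (c ^ 2 + ε ^ 2) ^ (r / 2 - 1) :=
    Real.rpow_le_rpow_of_nonpos (by positivity) (by linarith) (by linarith)
  have h3 : 0 ≤ r * (r - 1) := mul_nonneg (by linarith) (by linarith)
  calc r * (r - 1) * powDensity r ε a b
      ≤ r * (r - 1) * ((b - a) ^ 2 * (c ^ 2 + ε ^ 2) ^ (r / 2 - 1)) := by
        unfold powDensity; gcongr
    _ = (b - a) ^ 2 * (r * (r - 1) * (c ^ 2 + ε ^ 2) ^ (r / 2 - 1)) := by ring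
    _ ≤ _ := mul_le_mul_of_nonneg_left h1 (sq_nonneg _)
    _ = _ := by ring

theorem isConvexPotential_pow (hr : 1 < r) (hr2 : r ≤ 2) (hε : 0 < ε) :
    IsConvexPotential (powPotential r ε) (powPotentialDeriv r ε)
      (Real.toNNReal (r * (ε ^ 2) ^ (r / 2 - 1))) := by
  have hmono : ∀ a b, 0 ≤ (b - a) * (powPotentialDeriv r ε b - powPotentialDeriv r ε a) :=
    fun a b => le_trans (mul_nonneg (mul_nonneg (by linarith) (by linarith))
      (powDensity_nonneg a b)) (powDensity_le hr hr2 hε a b)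
  have htan : ∀ a b, powPotential r ε a + powPotentialDeriv r ε a * (b - a) ≤ powPotential r ε b := by
    intro a b
    rcases lt_trichotomy a b with hab | rfl | hab
    · obtain ⟨c, hc, hd⟩ := exists_hasDerivAt_eq_slope (powPotential r ε) _ hab
        (fun x _ => (hasDerivAt_powPotential hε x).continuousAt.continuousWithinAt)
        (fun x _ => hasDerivAt_powPotential hε x)
      rw [eq_div_iff (sub_pos.2 hab).ne'] at hd
      have := nonneg_of_mul_nonneg_right (hmono a c) (sub_pos.2 hc.1)
      nlinarith [sub_pos.2 hab]
    · simp
    · obtain ⟨c, hc, hd⟩ := exists_hasDerivAt_eq_slope (powPotential r ε) _ hab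
        (fun x _ => (hasDerivAt_powPotential hε x).continuousAt.continuousWithinAt)
        (fun x _ => hasDerivAt_powPotential hε x)
      rw [eq_div_iff (sub_pos.2 hab).ne'] at hd
      have := nonneg_of_mul_nonneg_right (hmono c a) (sub_pos.2 hc.2)
      nlinarith [sub_pos.2 hab]
  have h0 : powPotential r ε 0 = 0 := by simp [powPotential]
  have h0' : powPotentialDeriv r ε 0 = 0 := by simp [powPotentialDeriv]
  refine ⟨?_, h0', h0, fun a => ?_, htan⟩
  · refine lipschitzWith_of_nnnorm_deriv_le
      (fun x => (hasDerivAt_powPotentialDeriv hε x).differentiableAt) fun x => ?_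
    rw [(hasDerivAt_powPotentialDeriv hε x).deriv, ← NNReal.coe_le_coe, coe_nnnorm,
      Real.coe_toNNReal _ (by positivity), Real.norm_of_nonneg]
    · exact powPotentialDeriv_deriv_le hr hr2 hε x
    · refine le_trans ?_ (le_powPotentialDeriv_deriv hr hr2 hε x)
      have : 0 ≤ r - 1 := by linarith
      positivity
  · simpa [h0, h0'] using htan 0 a

/-- Away from `a = b = 0` the density is jointly continuous down to `ε = 0`; at the origin the
factor `(b - a)²` makes the left side vanish. This is the form needed for Fatou's lemma. -/
theorem powDensity_le_liminf {a b : ℝ} {ε' a' b' : ℕ → ℝ} (hε : Tendsto ε' atTop (𝓝 0))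
    (ha : Tendsto a' atTop (𝓝 a)) (hb : Tendsto b' atTop (𝓝 b)) :
    ENNReal.ofReal (powDensity r 0 a b) ≤
      liminf (fun n => ENNReal.ofReal (powDensity r (ε' n) (a' n) (b' n))) atTop := by
  by_cases h : max (a ^ 2) (b ^ 2) = 0
  · have ha0 : a = 0 := by
      have := (le_max_left (a ^ 2) (b ^ 2)).trans h.le
      nlinarith
    have hb0 : b = 0 := by
      have := (le_max_right (a ^ 2) (b ^ 2)).trans h.le
      nlinarith
    simp [powDensity, ha0, hb0]
  · refine (Tendsto.liminf_eq ?_).ge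
    refine ENNReal.tendsto_ofReal ?_
    unfold powDensity
    refine ((hb.sub ha).pow 2).mul (Tendsto.rpow_const ?_ (Or.inl (by simpa using h)))
    exact ((ha.pow 2).max (hb.pow 2)).add (hε.pow 2)

/-- The point where the modified weight matters: it vanishes unless `|b| ≤ |a|`, and then the
maximum in the density is `a²`, so the density times `|a| ^ (2 - r)` is exactly `(b - a)²`. -/
theorem sq_mul_chi_le (a b : ℝ) :
    ENNReal.ofReal ((b - a) ^ 2 * chi a b) ≤
      ENNReal.ofReal |a| ^ (2 - r) * ENNReal.ofReal (powDensity r 0 a b) := by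
  by_cases hab : |b| ≤ |a|
  · by_cases ha : a = 0
    · subst ha
      have : b = 0 := by simpa using hab
      simp [this]
    have hpos : 0 < |a| := abs_pos.2 ha
    rw [ENNReal.ofReal_rpow_of_pos hpos, ← ENNReal.ofReal_mul (by positivity)]
    refine ENNReal.ofReal_le_ofReal ?_
    have hchi : chi a b ≤ 1 := by
      unfold chi; split_ifs <;> norm_num
    have hmax : max (a ^ 2) (b ^ 2) + 0 ^ 2 = |a| ^ (2 : ℝ) := by
      rw [max_eq_left (sq_le_sq.2 hab)]; simp
    have : |a| ^ (2 - r) * powDensity r 0 a b = (b - a) ^ 2 := by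
      unfold powDensity
      rw [hmax, ← Real.rpow_mul hpos.le, mul_left_comm, ← Real.rpow_add hpos]
      ring_nf; simp
    rw [this]
    exact mul_le_of_le_one_right (by positivity) hchi
  · have : chi a b = 0 := by
      unfold chi
      rw [if_neg (by push Not at hab; exact hab.le.not_gt), if_neg fun h => hab h.ge]
    simp [this]

theorem measurable_powDensity (r ε : ℝ) : Measurable fun z : ℝ × ℝ => powDensity r ε z.1 z.2 := by
  unfold powDensity; fun_prop

end PowerPotential

/-! ### Integral functionals of convex potentials on `L²` -/

namespace IsConvexPotential

variable {E : Type*} [MeasurableSpace E] {m : Measure E} {φ ψ : ℝ → ℝ} {L : ℝ≥0}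

/-- The composition of the derivative of a convex potential with a function of `L²`. -/
noncomputable def grad (h : IsConvexPotential φ ψ L) (u : Lp ℝ 2 m) : Lp ℝ 2 m :=
  h.lipschitz.compLp h.deriv_zero u

theorem coeFn_grad (h : IsConvexPotential φ ψ L) (u : Lp ℝ 2 m) :
    h.grad u =ᵐ[m] fun x => ψ (u x) :=
  h.lipschitz.coeFn_compLp h.deriv_zero u

theorem integrable (h : IsConvexPotential φ ψ L) (u : Lp ℝ 2 m) :
    Integrable (fun x => φ (u x)) m := by
  have h2 : Integrable (fun x => L * (u x) ^ 2) m := ((Lp.memLp u).integrable_sq).const_mul _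
  refine h2.mono (h.continuous.comp_aestronglyMeasurable (Lp.aestronglyMeasurable u))
    (Eventually.of_forall fun x => ?_)
  rw [Real.norm_of_nonneg (h.nonneg _), Real.norm_of_nonneg (by positivity)]
  exact h.le_sq _

/-- The tangent inequality at `u x`, integrated. The gradient sits at `u`, the point whose value is
bounded from above. -/
theorem integral_sub_le (h : IsConvexPotential φ ψ L) (u v : Lp ℝ 2 m) :
    ∫ x, φ (u x) ∂m - ∫ x, φ (v x) ∂m ≤ inner ℝ (h.grad u) (u - v) := by
  rw [← integral_sub (h.integrable u) (h.integrable v), L2.inner_def]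
  refine integral_mono_ae ((h.integrable u).sub (h.integrable v)) (L2.integrable_inner _ _) ?_
  filter_upwards [h.coeFn_grad u, Lp.coeFn_sub u v] with x h1 h2
  simp only [h1, h2, Pi.sub_apply, RCLike.inner_apply, conj_trivial]
  have := h.tangent (u x) (v x)
  nlinarith

theorem abs_integral_sub_le (h : IsConvexPotential φ ψ L) (u v : Lp ℝ 2 m) :
    |∫ x, φ (u x) ∂m - ∫ x, φ (v x) ∂m| ≤ L * (‖u‖ + ‖v‖) * ‖u - v‖ := by
  have key : ∀ a b : Lp ℝ 2 m, ∫ x, φ (a x) ∂m - ∫ x, φ (b x) ∂m ≤ L * ‖a‖ * ‖a - b‖ :=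
    fun a b => (h.integral_sub_le a b).trans ((real_inner_le_norm _ _).trans
      (mul_le_mul_of_nonneg_right (h.lipschitz.norm_compLp_le h.deriv_zero a) (norm_nonneg _)))
  have h1 := key u v
  have h2 := key v u
  rw [norm_sub_rev] at h2
  have p1 : 0 ≤ L * ‖u‖ * ‖u - v‖ := by positivity
  have p2 : 0 ≤ L * ‖v‖ * ‖u - v‖ := by positivity
  rw [abs_le]; constructor <;> nlinarith

theorem continuous_integral (h : IsConvexPotential φ ψ L) :
    Continuous fun u : Lp ℝ 2 m => ∫ x, φ (u x) ∂m := by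
  rw [continuous_iff_continuousAt]
  intro v
  rw [ContinuousAt, tendsto_iff_dist_tendsto_zero]
  refine squeeze_zero (fun _ => dist_nonneg) (fun u => ?_)
    (g := fun u => L * (‖u‖ + ‖v‖) * ‖u - v‖) ?_
  · rw [Real.dist_eq]; exact h.abs_integral_sub_le u v
  · have : Continuous fun u : Lp ℝ 2 m => L * (‖u‖ + ‖v‖) * ‖u - v‖ := by fun_prop
    simpa using this.tendsto v

end IsConvexPotential

/-! ### Semigroup and form domain via convexity in time -/

namespace DirichletForm.IsSemigroup

variable {E : Type*} [MeasurableSpace E] {m : Measure E} {𝓔 : DirichletForm m}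
  {P : ℝ → Lp ℝ 2 m →L[ℝ] Lp ℝ 2 m}

theorem norm_sub_le (hP : 𝓔.IsSemigroup P) (f : Lp ℝ 2 m) {s t : ℝ} (hs : 0 ≤ s) (ht : 0 ≤ t) :
    ‖P t f - P s f‖ ≤ ‖P |t - s| f - f‖ := by
  wlog hst : s ≤ t generalizing s t
  · rw [norm_sub_rev, abs_sub_comm]; exact this ht hs (le_of_not_ge hst)
  have h0 : 0 ≤ t - s := by linarith
  have : P t f - P s f = P s (P (t - s) f - f) := by
    rw [map_sub, ← hP.add s (t - s) hs h0, add_sub_cancel]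
  rw [this, abs_of_nonneg h0]
  exact hP.contraction s hs _

theorem continuousOn (hP : 𝓔.IsSemigroup P) (f : Lp ℝ 2 m) :
    ContinuousOn (fun t => P t f) (Ici 0) := by
  have h0 : ContinuousWithinAt (fun t => P t f) (Ici 0) 0 := by
    rw [← continuousWithinAt_Ioi_iff_Ici, ContinuousWithinAt, hP.zero]
    exact hP.continuous f
  intro t ht
  have h1 : Tendsto (fun z => |z - t|) (𝓝[Ici 0] t) (𝓝[Ici 0] 0) := by
    refine tendsto_nhdsWithin_iff.2 ⟨?_, Eventually.of_forall fun z => mem_Ici.2 (abs_nonneg _)⟩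
    have : Continuous fun z : ℝ => |z - t| := by fun_prop
    simpa using (this.tendsto t).mono_left nhdsWithin_le_nhds
  rw [ContinuousWithinAt, tendsto_iff_norm_sub_tendsto_zero]
  refine squeeze_zero' (Eventually.of_forall fun _ => norm_nonneg _)
    (g := fun z => ‖P |z - t| f - f‖) ?_ ?_
  · filter_upwards [self_mem_nhdsWithin] with z hz using hP.norm_sub_le f ht hz
  · have h2 : Tendsto (fun z => P |z - t| f) (𝓝[Ici 0] t) (𝓝 f) := by
      have := h0.tendsto.comp h1
      rwa [hP.zero] at this
    simpa using (h2.sub_const f).norm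

theorem inner_apply_apply (hP : 𝓔.IsSemigroup P) (f : Lp ℝ 2 m) {s t : ℝ} (hs : 0 ≤ s)
    (ht : 0 ≤ t) : inner ℝ (P s f) (P t f) = inner ℝ (P (s + t) f) f := by
  rw [add_comm, hP.add t s ht hs, hP.symm t ht]

/-- Symmetry gives `⟪P ((s + t) / 2) f, f⟫ = ⟪P (s / 2) f, P (t / 2) f⟫`, so Cauchy–Schwarz yields
midpoint convexity of `t ↦ ⟪P t f, f⟫`. This convexity does the work of the spectral theorem. -/
theorem chord (hP : 𝓔.IsSemigroup P) (f : Lp ℝ 2 m) {x y c : ℝ} (hx : 0 ≤ x) (hxc : x ≤ c)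
    (hcy : c ≤ y) : (y - x) * inner ℝ (P c f) f ≤
      (y - c) * inner ℝ (P x f) f + (c - x) * inner ℝ (P y f) f := by
  refine chord_of_midpoint (g := fun t => inner ℝ (P t f) f)
    ((hP.continuousOn f).inner continuousOn_const) (fun s t hs ht => ?_) hx hxc hcy
  have h1 : inner ℝ (P ((s + t) / 2) f) f = inner ℝ (P (s / 2) f) (P (t / 2) f) := by
    rw [hP.inner_apply_apply f (by positivity) (by positivity)]; congr 3; ring
  have h2 : ∀ s, 0 ≤ s → inner ℝ (P s f) f = ‖P (s / 2) f‖ ^ 2 := fun s hs => by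
    rw [← real_inner_self_eq_norm_sq, hP.inner_apply_apply f (by positivity) (by positivity),
      add_halves]
  rw [h1, h2 s hs, h2 t ht]
  have := real_inner_le_norm (P (s / 2) f) (P (t / 2) f)
  nlinarith [sq_nonneg (‖P (s / 2) f‖ - ‖P (t / 2) f‖)]

/-- The approximating quadratic form `t⁻¹ ⟪u - P t u, u⟫` is monotone in `t`. -/
theorem antitoneOn_approx (hP : 𝓔.IsSemigroup P) (u : Lp ℝ 2 m) :
    AntitoneOn (fun t : ℝ => 1 / t * inner ℝ (u - P t u) u) (Ioi 0) := by
  intro s hs t ht hst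
  rw [mem_Ioi] at hs ht
  have h := hP.chord u le_rfl hs.le hst
  rw [hP.zero] at h
  simp only [inner_sub_left]
  rw [one_div_mul_eq_div, one_div_mul_eq_div, div_le_div_iff₀ ht hs]
  nlinarith

/-- The approximating forms increase as `t` decreases to zero, so an upper bound already forces the
limit that characterizes the domain to exist. -/
theorem mem_domain_of_bound (hP : 𝓔.IsSemigroup P) {u : Lp ℝ 2 m} {C : ℝ}
    (h : ∀ t > (0 : ℝ), 1 / t * inner ℝ (u - P t u) u ≤ C) : u ∈ 𝓔.domain := by
  rw [hP.mem_domain_iff]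
  refine ⟨_, (hP.antitoneOn_approx u).tendsto_nhdsGT ⟨C, ?_⟩⟩
  rintro _ ⟨t, ht, rfl⟩
  exact h t ht

theorem approx_le_form (hP : 𝓔.IsSemigroup P) (u : 𝓔.domain) {t : ℝ} (ht : 0 < t) :
    1 / t * inner ℝ ((u : Lp ℝ 2 m) - P t u) (u : Lp ℝ 2 m) ≤ 𝓔.form u u := by
  refine ge_of_tendsto (hP.form_eq u u) ?_
  filter_upwards [Ioc_mem_nhdsGT ht] with s hs
  exact hP.antitoneOn_approx u hs.1 ht hs.2

/-- For `P t f` the approximating form at time `s` is the negative slope of `τ ↦ ⟪P τ f, f⟫` on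
`[2t, 2t + s]`. By convexity it is at most the negative slope on `[0, 2t]`, which does not depend on
`s`. -/
theorem apply_mem_domain (hP : 𝓔.IsSemigroup P) (f : Lp ℝ 2 m) {t : ℝ} (ht : 0 < t) :
    P t f ∈ 𝓔.domain := by
  refine hP.mem_domain_of_bound
    (C := (inner ℝ (P 0 f) f - inner ℝ (P (2 * t) f) f) / (2 * t)) fun s hs => ?_
  have h := hP.chord f (x := 0) (c := 2 * t) (y := 2 * t + s) le_rfl (by linarith) (by linarith)
  have e1 : inner ℝ (P t f) (P t f) = inner ℝ (P (2 * t) f) f := by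
    rw [hP.inner_apply_apply f ht.le ht.le, two_mul]
  have e2 : inner ℝ (P s (P t f)) (P t f) = inner ℝ (P (2 * t + s) f) f := by
    rw [← hP.add s t hs.le ht.le, hP.inner_apply_apply f (by linarith) ht.le]; congr 3; ring
  rw [inner_sub_left, e1, e2, one_div_mul_eq_div, div_le_div_iff₀ hs (by linarith)]
  nlinarith

/-- Expanding the square gives `‖u - P s u‖² = 2 ⟪u - P s u, u⟫ - ⟪u - P (2s) u, u⟫`; after division
by `s` both terms tend to `2 𝓔(u, u)` and cancel. It makes the second-order error in
`exists_slope_le` negligible. -/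
theorem tendsto_norm_sq_div (hP : 𝓔.IsSemigroup P) (u : 𝓔.domain) :
    Tendsto (fun s : ℝ => 1 / s * ‖(u : Lp ℝ 2 m) - P s u‖ ^ 2) (𝓝[>] 0) (𝓝 0) := by
  have h1 := hP.form_eq u u
  have h2 : Tendsto (fun s : ℝ => 2 * s) (𝓝[>] 0) (𝓝[>] 0) := by
    refine tendsto_nhdsWithin_iff.2 ⟨?_, ?_⟩
    · have : Continuous fun s : ℝ => 2 * s := by fun_prop
      simpa using (this.tendsto 0).mono_left nhdsWithin_le_nhds
    · filter_upwards [self_mem_nhdsWithin] with s hs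
      rw [mem_Ioi] at *; linarith
  have h3 := (h1.const_mul 2).sub ((h1.comp h2).const_mul 2)
  rw [sub_self] at h3
  refine h3.congr' ?_
  filter_upwards [self_mem_nhdsWithin] with s hs
  rw [mem_Ioi] at hs
  have e1 : ‖P s (u : Lp ℝ 2 m)‖ ^ 2 = inner ℝ (P (2 * s) (u : Lp ℝ 2 m)) (u : Lp ℝ 2 m) := by
    rw [← real_inner_self_eq_norm_sq, hP.inner_apply_apply _ hs.le hs.le, two_mul]
  simp only [Function.comp, inner_sub_left]
  rw [norm_sub_sq_real, e1, real_inner_comm (P s (u : Lp ℝ 2 m)), real_inner_self_eq_norm_sq]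
  field_simp
  ring

end DirichletForm.IsSemigroup

/-! ### Decay of convex functionals along the semigroup -/

/-- Along the semigroup, the upper right derivative of the integral of a convex potential `φ` is
at most `- 𝓔 (u, φ' ∘ u)`. -/
theorem DirichletForm.IsSemigroup.exists_slope_le {E : Type*} [MeasurableSpace E] {m : Measure E}
    {𝓔 : DirichletForm m} {P : ℝ → Lp ℝ 2 m →L[ℝ] Lp ℝ 2 m} (hP : 𝓔.IsSemigroup P)
    {φ ψ : ℝ → ℝ} {L : ℝ≥0} (h : IsConvexPotential φ ψ L) (f : Lp ℝ 2 m) {t : ℝ} (ht : 0 < t)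
    (hg : h.grad (P t f) ∈ 𝓔.domain) :
    ∃ B : ℝ → ℝ, (∀ᶠ z in 𝓝[>] t, slope (fun t => ∫ x, φ (P t f x) ∂m) t z ≤ B z) ∧
      Tendsto B (𝓝[>] t) (𝓝 (-𝓔.form ⟨P t f, hP.apply_mem_domain f ht⟩ ⟨_, hg⟩)) := by
  set u : 𝓔.domain := ⟨P t f, hP.apply_mem_domain f ht⟩ with hu
  set w : 𝓔.domain := ⟨h.grad (P t f), hg⟩ with hw
  have h1 := (hP.form_eq u w).neg.add ((hP.tendsto_norm_sq_div u).const_mul (L : ℝ))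
  rw [mul_zero, add_zero] at h1
  have h2 : Tendsto (fun z => z - t) (𝓝[>] t) (𝓝[>] 0) := by
    refine tendsto_nhdsWithin_iff.2 ⟨?_, ?_⟩
    · have : Continuous fun z : ℝ => z - t := by fun_prop
      simpa using (this.tendsto t).mono_left nhdsWithin_le_nhds
    · filter_upwards [self_mem_nhdsWithin] with s hs
      rw [mem_Ioi] at *; linarith
  refine ⟨_, ?_, h1.comp h2⟩
  filter_upwards [self_mem_nhdsWithin] with z hz
  rw [mem_Ioi] at hz
  have hs : 0 < z - t := by linarith
  have hz' : P z f = P (z - t) (P t f) := by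
    rw [← hP.add _ _ hs.le ht.le, sub_add_cancel]
  -- Convexity puts the gradient at time `z`. Moving it to time `t` costs at most `L ‖P t f - P z
  -- f‖²` by the Lipschitz bound, which is `o(z - t)`.
  have e1 := h.integral_sub_le (P z f) (P t f)
  have e2 : inner ℝ (h.grad (P z f)) (P z f - P t f) =
      inner ℝ (h.grad (P z f) - h.grad (P t f)) (P z f - P t f)
        - inner ℝ (P t f - P z f) (h.grad (P t f)) := by
    rw [inner_sub_left, real_inner_comm (h.grad (P t f)) (P t f - P z f), ← neg_sub (P z f), inner_neg_right]
    ring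
  have e3 : inner ℝ (h.grad (P z f) - h.grad (P t f)) (P z f - P t f) ≤
      L * ‖P t f - P z f‖ ^ 2 := by
    refine (real_inner_le_norm _ _).trans ?_
    have := h.lipschitz.norm_compLp_sub_le h.deriv_zero (P z f) (P t f)
    rw [norm_sub_rev (P t f)]
    calc _ ≤ (L * ‖P z f - P t f‖) * ‖P z f - P t f‖ :=
          mul_le_mul_of_nonneg_right this (norm_nonneg _)
      _ = _ := by ring
  rw [slope_def_field, div_le_iff₀ hs]
  simp only [Function.comp, hu, hw, ← hz']
  have e4 : (-(1 / (z - t) * inner ℝ (P t f - P z f) (h.grad (P t f))) +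
      L * (1 / (z - t) * ‖P t f - P z f‖ ^ 2)) * (z - t) =
      - inner ℝ (P t f - P z f) (h.grad (P t f)) + L * ‖P t f - P z f‖ ^ 2 := by
    field_simp
  rw [e4]
  linarith

/-- For positive times the hypothesis makes the upper right derivative non-positive. Time zero is
reached by continuity, since `f` itself need not lie in the domain. -/
theorem DirichletForm.IsSemigroup.integral_potential_antitone {E : Type*} [MeasurableSpace E]
    {m : Measure E} {𝓔 : DirichletForm m} {P : ℝ → Lp ℝ 2 m →L[ℝ] Lp ℝ 2 m}
    (hP : 𝓔.IsSemigroup P) {φ ψ : ℝ → ℝ} {L : ℝ≥0} (h : IsConvexPotential φ ψ L) (f : Lp ℝ 2 m)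
    (hg : ∀ u : 𝓔.domain, ∃ hu : h.grad (u : Lp ℝ 2 m) ∈ 𝓔.domain, 0 ≤ 𝓔.form u ⟨_, hu⟩) :
    AntitoneOn (fun t => ∫ x, φ (P t f x) ∂m) (Ici 0) := by
  have hc : ContinuousOn (fun t => ∫ x, φ (P t f x) ∂m) (Ici 0) :=
    h.continuous_integral.comp_continuousOn (hP.continuousOn f)
  have key : ∀ s t, 0 < s → s ≤ t → ∫ x, φ (P t f x) ∂m ≤ ∫ x, φ (P s f x) ∂m := by
    intro s t hs hst
    refine image_le_of_liminf_slope_right_le_deriv_boundary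
      (f := fun t => ∫ x, φ (P t f x) ∂m) (B := fun _ => ∫ x, φ (P s f x) ∂m) (B' := fun _ => 0)
      (hc.mono fun z hz => hs.le.trans hz.1) le_rfl continuousOn_const
      (fun x _ => hasDerivWithinAt_const _ _ _) (fun x hx r hr => ?_) ⟨hst, le_rfl⟩
    have hx0 : 0 < x := hs.trans_le hx.1
    obtain ⟨hu, hpos⟩ := hg ⟨P x f, hP.apply_mem_domain f hx0⟩
    obtain ⟨B, hB, hlim⟩ := hP.exists_slope_le h f hx0 hu
    refine Eventually.frequently ?_
    filter_upwards [hB, hlim.eventually_lt_const (lt_of_le_of_lt (neg_nonpos.2 hpos) hr)]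
      with z h1 h2 using h1.trans_lt h2
  intro s hs t ht hst
  rcases eq_or_lt_of_le (mem_Ici.1 hs) with rfl | hs0
  · rcases eq_or_lt_of_le hst with rfl | hst'
    · exact le_rfl
    · have h0 : Tendsto (fun t => ∫ x, φ (P t f x) ∂m) (𝓝[>] 0) (𝓝 (∫ x, φ (P 0 f x) ∂m)) :=
        (hc 0 hs).mono Ioi_subset_Ici_self
      refine ge_of_tendsto h0 ?_
      filter_upwards [Ioc_mem_nhdsGT hst'] with z hz using key z t hz.1 hz.2
  · exact key s t hs0 hst

/-! ### Sub-Markovianity from the unit contraction -/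

section SubMarkov

variable {E : Type*} [MeasurableSpace E] {m : Measure E}

/-- Let `v` be `u` clamped to `[0, 1]`. For `0 < ε < 1`, `v + ε (u - v)` also clamps to `v`, so the
Markov property makes its energy at least that of `v`. The first-order term in `ε` gives `𝓔(v, u -
v) ≥ 0`, and `𝓔(u - v, u - v) ≥ 0` is added. -/
theorem DirichletForm.form_sub_clamp_nonneg (𝓔 : DirichletForm m) (u : 𝓔.domain) :
    ∃ hu : IsConvexPotential.sq_dist_unitInterval.grad (u : Lp ℝ 2 m) ∈ 𝓔.domain,
      0 ≤ 𝓔.form u ⟨_, hu⟩ := by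
  have hlip : LipschitzWith 1 fun a : ℝ => max 0 (min a 1) :=
    (LipschitzWith.id.min_const 1).const_max 0
  set v := hlip.compLp (by simp) (u : Lp ℝ 2 m) with hv
  have hvae : v =ᵐ[m] fun x => max 0 (min ((u : Lp ℝ 2 m) x) 1) := hlip.coeFn_compLp (by simp) _
  obtain ⟨hvm, -⟩ := 𝓔.markov u v hvae
  set v' : 𝓔.domain := ⟨v, hvm⟩ with hv'
  have hgrad : IsConvexPotential.sq_dist_unitInterval.grad (u : Lp ℝ 2 m) = (u - v' : 𝓔.domain) := by
    refine Lp.ext ?_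
    filter_upwards [IsConvexPotential.sq_dist_unitInterval.coeFn_grad (u : Lp ℝ 2 m), hvae,
      Lp.coeFn_sub (u : Lp ℝ 2 m) v] with x h1 h2 h3
    simp only [Submodule.coe_sub, hv', h1, h3, Pi.sub_apply, h2]
  refine ⟨hgrad ▸ (u - v').2, ?_⟩
  have hsub : (⟨_, hgrad ▸ (u - v').2⟩ : 𝓔.domain) = u - v' := Subtype.ext hgrad
  rw [hsub]
  have key : ∀ ε : ℝ, 0 < ε → ε < 1 →
      0 ≤ 2 * 𝓔.form v' (u - v') + ε * 𝓔.form (u - v') (u - v') := by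
    intro ε h0 h1
    obtain ⟨hv2, hle⟩ := 𝓔.markov (v' + ε • (u - v')) v (by
      have e : ((v' + ε • (u - v') : 𝓔.domain) : Lp ℝ 2 m) =
        v + ε • ((u : Lp ℝ 2 m) - v) := rfl
      rw [e]
      filter_upwards [hvae, Lp.coeFn_add v (ε • ((u : Lp ℝ 2 m) - v)),
        Lp.coeFn_smul ε ((u : Lp ℝ 2 m) - v), Lp.coeFn_sub (u : Lp ℝ 2 m) v] with x e1 e2 e3 e4
      rw [e2, Pi.add_apply, e3, Pi.smul_apply, e4, Pi.sub_apply, e1, smul_eq_mul]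
      generalize (u : Lp ℝ 2 m) x = a
      rcases le_total a 0 with ha | ha
      · rw [min_eq_left (by linarith), max_eq_left ha, min_eq_left (by nlinarith), max_eq_left (by nlinarith)]
      rcases le_total a 1 with ha1 | ha1
      · rw [min_eq_left ha1, max_eq_right ha]; simp [ha, ha1]
      · rw [min_eq_right ha1, max_eq_right zero_le_one, min_eq_right (by nlinarith), max_eq_right zero_le_one])
    have hexp : 𝓔.form (v' + ε • (u - v')) (v' + ε • (u - v')) =
        𝓔.form v' v' + ε * (2 * 𝓔.form v' (u - v') + ε * 𝓔.form (u - v') (u - v')) := by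
      simp only [map_add, LinearMap.add_apply, map_smul, LinearMap.smul_apply, smul_eq_mul]
      rw [𝓔.symm (u - v') v']; ring
    rw [hexp] at hle
    exact nonneg_of_mul_nonneg_right (by linarith) h0
  have hlim : 0 ≤ 2 * 𝓔.form v' (u - v') := by
    have hc : Tendsto (fun ε : ℝ => 2 * 𝓔.form v' (u - v') + ε * 𝓔.form (u - v') (u - v'))
        (𝓝[>] 0) (𝓝 (2 * 𝓔.form v' (u - v'))) := by
      have : Continuous fun ε : ℝ => 2 * 𝓔.form v' (u - v') + ε * 𝓔.form (u - v') (u - v') := by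
        fun_prop
      simpa using (this.tendsto 0).mono_left nhdsWithin_le_nhds
    refine ge_of_tendsto hc ?_
    filter_upwards [Ioo_mem_nhdsGT (zero_lt_one' ℝ)] with ε hε using key ε hε.1 hε.2
  have hsplit : 𝓔.form u (u - v') = 𝓔.form v' (u - v') + 𝓔.form (u - v') (u - v') := by
    rw [← LinearMap.add_apply, ← map_add]; simp
  have := 𝓔.nonneg (u - v')
  linarith

/-- A bounded operator on `L²` is sub-Markovian if it preserves the functions with values
in `[0, 1]`. -/
def IsSubMarkov (S : Lp ℝ 2 m →L[ℝ] Lp ℝ 2 m) : Prop :=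
  ∀ f : Lp ℝ 2 m, (∀ᵐ x ∂m, 0 ≤ f x ∧ f x ≤ 1) → ∀ᵐ x ∂m, 0 ≤ S f x ∧ S f x ≤ 1

/-- The integral of the squared distance to `[0, 1]` is non-negative, antitone in time and zero at
the start, hence zero forever. -/
theorem DirichletForm.IsSemigroup.isSubMarkov {𝓔 : DirichletForm m}
    {P : ℝ → Lp ℝ 2 m →L[ℝ] Lp ℝ 2 m} (hP : 𝓔.IsSemigroup P) {t : ℝ} (ht : 0 ≤ t) :
    IsSubMarkov (P t) := by
  intro f hf
  have h := IsConvexPotential.sq_dist_unitInterval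
  have hanti := hP.integral_potential_antitone h f 𝓔.form_sub_clamp_nonneg
    (mem_Ici.2 le_rfl) (mem_Ici.2 ht) ht
  have h0 : ∫ x, (P 0 f x - max 0 (min (P 0 f x) 1)) ^ 2 / 2 ∂m = 0 := by
    refine integral_eq_zero_of_ae ?_
    rw [hP.zero]
    filter_upwards [hf] with x hx
    simp [hx.1, hx.2]
  simp only [h0] at hanti
  have h1 := le_antisymm hanti (integral_nonneg fun x => by positivity)
  rw [integral_eq_zero_iff_of_nonneg (fun x => h.nonneg _) (h.integrable _)] at h1
  filter_upwards [h1] with x hx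
  have hx2 : P t f x - max 0 (min (P t f x) 1) = 0 := by
    simpa using hx
  rw [sub_eq_zero] at hx2
  rw [hx2]
  exact ⟨le_max_left _ _, max_le zero_le_one (min_le_right _ _)⟩

end SubMarkov

/-! ### Maximal inequality for symmetric sub-Markov matrices -/

theorem rpow_sub_one_mul_le {r x a : ℝ} (hr : 1 < r) (hx : 0 ≤ x) (ha : 0 ≤ a) :
    x ^ (r - 1) * a ≤ (r - 1) / r * x ^ r + a ^ r / r := by
  have hpq : r.HolderConjugate (r / (r - 1)) := Real.HolderConjugate.conjExponent hr
  have h := Real.young_inequality_of_nonneg ha (Real.rpow_nonneg hx (r - 1)) hpq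
  have h1 : r - 1 ≠ 0 := by linarith
  rw [← Real.rpow_mul hx, show (r - 1) * (r / (r - 1)) = r by field_simp] at h
  rw [mul_comm]
  refine h.trans (le_of_eq ?_)
  field_simp
  ring

/-- A matrix `q` with non-negative entries and row sums at most one that is symmetric for the
weights `w`. -/
structure IsSubMarkovMatrix {ι : Type*} [Fintype ι] (w : ι → ℝ) (q : ι → ι → ℝ) : Prop where
  weight_nonneg : ∀ i, 0 ≤ w i
  nonneg : ∀ i j, 0 ≤ q i j
  sum_le_one : ∀ i, ∑ j, q i j ≤ 1
  symm : ∀ i j, w i * q i j = w j * q j i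

/-- The action of a matrix on functions. -/
def matrixAct {ι : Type*} [Fintype ι] (q : ι → ι → ℝ) (f : ι → ℝ) (i : ι) : ℝ := ∑ j, q i j * f j

/-- The expectation of `Φ (Y k, max (v 0 (Y 0), …, v k (Y k)))` along the stationary chain `Y` with
transition matrix `q` and reference weights `w`, where the mass that is killed in a step is
restored by paths born at that time. -/
def runningMaxExpect {ι : Type*} [Fintype ι] (w : ι → ℝ) (q : ι → ι → ℝ) (v : ℕ → ι → ℝ) :
    ℕ → (ι → ℝ → ℝ) → ℝ
  | 0, Φ => ∑ i, w i * Φ i (v 0 i)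
  | k + 1, Φ => runningMaxExpect w q v k (fun i b => ∑ j, q i j * Φ j (max b (v (k + 1) j))) +
      ∑ i, w i * (1 - ∑ j, q i j) * Φ i (v (k + 1) i)

namespace IsSubMarkovMatrix

variable {ι : Type*} [Fintype ι] {w : ι → ℝ} {q : ι → ι → ℝ} {v : ℕ → ι → ℝ}

theorem sum_mul_matrixAct (h : IsSubMarkovMatrix w q) (f g : ι → ℝ) :
    ∑ i, w i * f i * matrixAct q g i = ∑ i, w i * matrixAct q f i * g i := by
  simp only [matrixAct, Finset.mul_sum, Finset.sum_mul]
  rw [Finset.sum_comm]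
  refine Finset.sum_congr rfl fun i _ => Finset.sum_congr rfl fun j _ => ?_
  linear_combination (f j * g i) * h.symm j i

theorem matrixAct_nonneg (h : IsSubMarkovMatrix w q) {f : ι → ℝ} (hf : ∀ i, 0 ≤ f i) (i : ι) :
    0 ≤ matrixAct q f i :=
  Finset.sum_nonneg fun j _ => mul_nonneg (h.nonneg i j) (hf j)

theorem iterate_nonneg (h : IsSubMarkovMatrix w q) {f : ι → ℝ} (hf : ∀ i, 0 ≤ f i) (n : ℕ) :
    ∀ i, 0 ≤ (matrixAct q)^[n] f i := by
  induction n with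
  | zero => exact hf
  | succ n ih => rw [Function.iterate_succ_apply']; exact h.matrixAct_nonneg ih

theorem abs_iterate_le (h : IsSubMarkovMatrix w q) (f : ι → ℝ) (n : ℕ) :
    ∀ i, |(matrixAct q)^[n] f i| ≤ (matrixAct q)^[n] (fun i => |f i|) i := by
  induction n with
  | zero => exact fun i => le_rfl
  | succ n ih =>
    intro i
    rw [Function.iterate_succ_apply', Function.iterate_succ_apply']
    refine (Finset.abs_sum_le_sum_abs _ _).trans (Finset.sum_le_sum fun j _ => ?_)
    rw [abs_mul, abs_of_nonneg (h.nonneg i j)]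
    exact mul_le_mul_of_nonneg_left (ih j) (h.nonneg i j)

theorem birth_nonneg (h : IsSubMarkovMatrix w q) (i : ι) : 0 ≤ w i * (1 - ∑ j, q i j) :=
  mul_nonneg (h.weight_nonneg i) (sub_nonneg.2 (h.sum_le_one i))

theorem runningMaxExpect_mono (h : IsSubMarkovMatrix w q) (k : ℕ) :
    ∀ {Φ Ψ : ι → ℝ → ℝ}, (∀ i b, v k i ≤ b → Φ i b ≤ Ψ i b) →
      runningMaxExpect w q v k Φ ≤ runningMaxExpect w q v k Ψ := by
  induction k with
  | zero =>
    intro Φ Ψ hle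
    exact Finset.sum_le_sum fun i _ => mul_le_mul_of_nonneg_left (hle i _ le_rfl) (h.weight_nonneg i)
  | succ k ih =>
    intro Φ Ψ hle
    refine add_le_add (ih fun i b _ => Finset.sum_le_sum fun j _ =>
      mul_le_mul_of_nonneg_left (hle j _ (le_max_right _ _)) (h.nonneg i j))
      (Finset.sum_le_sum fun i _ => mul_le_mul_of_nonneg_left (hle i _ le_rfl) (h.birth_nonneg i))

theorem runningMaxExpect_add (k : ℕ) :
    ∀ Φ Ψ : ι → ℝ → ℝ, runningMaxExpect w q v k (fun i b => Φ i b + Ψ i b) =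
      runningMaxExpect w q v k Φ + runningMaxExpect w q v k Ψ := by
  induction k with
  | zero => intro Φ Ψ; simp [runningMaxExpect, mul_add, Finset.sum_add_distrib]
  | succ k ih =>
    intro Φ Ψ
    simp only [runningMaxExpect, mul_add, Finset.sum_add_distrib, ih]
    ring

theorem runningMaxExpect_mul (k : ℕ) (c : ℝ) :
    ∀ Φ : ι → ℝ → ℝ, runningMaxExpect w q v k (fun i b => c * Φ i b) =
      c * runningMaxExpect w q v k Φ := by
  induction k with
  | zero => intro Φ; simp [runningMaxExpect, Finset.mul_sum, mul_left_comm]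
  | succ k ih =>
    intro Φ
    simp only [runningMaxExpect, mul_left_comm _ c, ← Finset.mul_sum, ih]
    ring

theorem runningMaxExpect_sum {κ : Type*} (s : Finset κ) (k : ℕ) (Φ : κ → ι → ℝ → ℝ) :
    runningMaxExpect w q v k (fun i b => ∑ c ∈ s, Φ c i b) =
      ∑ c ∈ s, runningMaxExpect w q v k (Φ c) := by
  classical
  induction s using Finset.induction_on with
  | empty =>
    simp only [Finset.sum_empty]
    simpa using runningMaxExpect_mul (w := w) (q := q) (v := v) k 0 fun _ _ => 0
  | insert a s ha ih => simp only [Finset.sum_insert ha, runningMaxExpect_add, ih]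

/-- Stationarity: by symmetry the mass of `w` lost at `i` in one step is `w i` times the row defect,
exactly what the births restore, so the chain has law `w` at every time. -/
theorem runningMaxExpect_const (h : IsSubMarkovMatrix w q) (k : ℕ) :
    ∀ g : ι → ℝ, runningMaxExpect w q v k (fun i _ => g i) = ∑ i, w i * g i := by
  induction k with
  | zero => intro g; rfl
  | succ k ih =>
    intro g
    simp only [runningMaxExpect]
    rw [ih fun i => ∑ j, q i j * g j]
    have h1 := h.sum_mul_matrixAct (fun _ => 1) g
    simp only [matrixAct, mul_one] at h1
    rw [h1, ← Finset.sum_add_distrib]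
    exact Finset.sum_congr rfl fun i _ => by ring

/-- Time reversal: symmetry moves one factor of `q` at a time from `v (k - j)` onto `g`, which is
one step back along the chain. After `j` steps the running maximum dominates `v (k - j)`; the births
contribute a non-negative amount. -/
theorem sum_le_runningMaxExpect (h : IsSubMarkovMatrix w q) (hv : ∀ k i, 0 ≤ v k i) (k : ℕ) :
    ∀ (g : ι → ℝ) (_ : ∀ i, 0 ≤ g i) (j : ℕ), j ≤ k →
      ∑ i, w i * g i * (matrixAct q)^[j] (v (k - j)) i ≤
        runningMaxExpect w q v k (fun i b => g i * b) := by
  have zero : ∀ (k : ℕ) (g : ι → ℝ) (_ : ∀ i, 0 ≤ g i), ∑ i, w i * g i * v k i ≤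
      runningMaxExpect w q v k (fun i b => g i * b) := by
    intro k g hg
    have h1 := h.runningMaxExpect_const (v := v) k fun i => g i * v k i
    simp only [← mul_assoc] at h1
    rw [← h1]
    exact h.runningMaxExpect_mono k fun i b hb => mul_le_mul_of_nonneg_left hb (hg i)
  induction k with
  | zero =>
    intro g hg j hj
    obtain rfl : j = 0 := by omega
    exact zero 0 g hg
  | succ k ih =>
    intro g hg j hj
    rcases j with _ | j
    · exact zero (k + 1) g hg
    · rw [Nat.add_sub_add_right, Function.iterate_succ_apply']
      rw [h.sum_mul_matrixAct]
      refine (ih _ (h.matrixAct_nonneg hg) j (by omega)).trans ?_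
      simp only [runningMaxExpect]
      have hb : 0 ≤ ∑ i, w i * (1 - ∑ j, q i j) * (g i * v (k + 1) i) :=
        Finset.sum_nonneg fun i _ => mul_nonneg (h.birth_nonneg i) (mul_nonneg (hg i) (hv _ i))
      refine le_trans ?_ (le_add_of_nonneg_right hb)
      refine h.runningMaxExpect_mono k fun i b _ => ?_
      simp only [matrixAct, Finset.sum_mul, mul_assoc]
      exact Finset.sum_le_sum fun j _ => mul_le_mul_of_nonneg_left
        (mul_le_mul_of_nonneg_left (le_max_left _ _) (hg j)) (h.nonneg i j)

/-- The Bellman function for Doob's inequality is `b^(r - 1) a - (r - 1) / r * b^r`, with `a` the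
current value and `b` the running maximum. Its linear part in `a` is preserved by `v k = q v (k +
1)`, and updating the maximum can only increase it: a new record gives `a^r / r`, larger by Young's
inequality. Killing drops part of the subtracted term, and births start on the diagonal, where the
function is non-negative. -/
theorem runningMaxExpect_bellman (h : IsSubMarkovMatrix w q) (hv : ∀ k i, 0 ≤ v k i) {N : ℕ}
    (hstep : ∀ k < N, v k = matrixAct q (v (k + 1))) {r : ℝ} (hr : 1 < r) (k : ℕ) (hk : k ≤ N) :
    0 ≤ runningMaxExpect w q v k (fun i b => b ^ (r - 1) * v k i - (r - 1) / r * b ^ r) := by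
  have hc : 0 ≤ (r - 1) / r := div_nonneg (by linarith) (by linarith)
  have diag : ∀ a : ℝ, 0 ≤ a → a ^ (r - 1) * a - (r - 1) / r * a ^ r = a ^ r / r := by
    intro a ha
    rw [← Real.rpow_add_one' ha (by linarith), sub_add_cancel]
    field_simp; ring
  have diag0 : ∀ a : ℝ, 0 ≤ a → 0 ≤ a ^ (r - 1) * a - (r - 1) / r * a ^ r := fun a ha => by
    rw [diag a ha]; positivity
  induction k with
  | zero => exact Finset.sum_nonneg fun i _ => mul_nonneg (h.weight_nonneg i) (diag0 _ (hv 0 i))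
  | succ k ih =>
    simp only [runningMaxExpect]
    refine add_nonneg ((ih (by omega)).trans (h.runningMaxExpect_mono k fun i b hb => ?_))
      (Finset.sum_nonneg fun i _ => mul_nonneg (h.birth_nonneg i) (diag0 _ (hv _ i)))
    have hb0 : 0 ≤ b := (hv k i).trans hb
    have hstep' : v k i = ∑ j, q i j * v (k + 1) j := congrFun (hstep k (by omega)) i
    calc b ^ (r - 1) * v k i - (r - 1) / r * b ^ r
        ≤ b ^ (r - 1) * v k i - (∑ j, q i j) * ((r - 1) / r * b ^ r) := by
          have : 0 ≤ (r - 1) / r * b ^ r := by positivity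
          nlinarith [h.sum_le_one i]
      _ = ∑ j, q i j * (b ^ (r - 1) * v (k + 1) j - (r - 1) / r * b ^ r) := by
          rw [hstep', Finset.mul_sum, Finset.sum_mul, ← Finset.sum_sub_distrib]
          exact Finset.sum_congr rfl fun j _ => by ring
      _ ≤ _ := Finset.sum_le_sum fun j _ => mul_le_mul_of_nonneg_left ?_ (h.nonneg i j)
    have ha := hv (k + 1) j
    rcases le_total (v (k + 1) j) b with hab | hab
    · rw [max_eq_left hab]
    · rw [max_eq_right hab, diag _ ha]
      linarith [rpow_sub_one_mul_le hr hb0 ha]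

/-- Doob's inequality: the Bellman bound at the final time, with Young's inequality absorbing half
of the maximal term. -/
theorem runningMaxExpect_rpow_le (h : IsSubMarkovMatrix w q) (hv : ∀ k i, 0 ≤ v k i) {N : ℕ}
    (hstep : ∀ k < N, v k = matrixAct q (v (k + 1))) {r : ℝ} (hr : 1 < r) :
    runningMaxExpect w q v N (fun _ b => b ^ r) ≤ 2 ^ r / (r - 1) * ∑ i, w i * v N i ^ r := by
  have hB := h.runningMaxExpect_bellman hv hstep hr N le_rfl
  have hr0 : 0 < r := by linarith
  have hr1 : 0 < r - 1 := by linarith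
  have hle := h.runningMaxExpect_mono (v := v) N
    (Φ := fun i b => b ^ (r - 1) * v N i - (r - 1) / r * b ^ r)
    (Ψ := fun i b => 2 ^ (r - 1) / r * v N i ^ r + (-((r - 1) / (2 * r))) * b ^ r) (by
      intro i b hb
      have hb0 : 0 ≤ b := (hv N i).trans hb
      -- The scale in Young's inequality is chosen with `l ^ r = 1 / 2`, so that exactly half of the
      -- term `(r - 1) / r * b ^ r` is absorbed.
      set l : ℝ := 2 ^ (-(1 / r)) with hl
      have hl0 : 0 < l := by positivity
      have hlr : l ^ r = 1 / 2 := by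
        rw [hl, ← Real.rpow_mul zero_le_two, show -(1 / r) * r = -1 by field_simp, Real.rpow_neg_one]
        norm_num
      have hlr' : (l ^ (-(r - 1))) ^ r = 2 ^ (r - 1) := by
        rw [hl, ← Real.rpow_mul zero_le_two, ← Real.rpow_mul zero_le_two]; congr 1; field_simp
      have hy := rpow_sub_one_mul_le hr (mul_nonneg hl0.le hb0)
        (mul_nonneg (Real.rpow_nonneg hl0.le (-(r - 1))) (hv N i))
      rw [Real.mul_rpow hl0.le hb0, Real.mul_rpow hl0.le hb0, hlr,
        Real.mul_rpow (Real.rpow_nonneg hl0.le _) (hv N i), hlr'] at hy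
      have e : l ^ (r - 1) * b ^ (r - 1) * (l ^ (-(r - 1)) * v N i) = b ^ (r - 1) * v N i := by
        rw [Real.rpow_neg hl0.le]
        have : l ^ (r - 1) ≠ 0 := by positivity
        field_simp
      rw [e] at hy
      have e2 : (r - 1) / r * (1 / 2 * b ^ r) = (r - 1) / r * b ^ r + (-((r - 1) / (2 * r))) * b ^ r := by
        field_simp; ring
      have e3 : 2 ^ (r - 1) * v N i ^ r / r = 2 ^ (r - 1) / r * v N i ^ r := by ring
      linarith)
  rw [runningMaxExpect_add, runningMaxExpect_mul, runningMaxExpect_mul, h.runningMaxExpect_const N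
    fun i => v N i ^ r] at hle
  have h1 : (r - 1) / (2 * r) * runningMaxExpect w q v N (fun _ b => b ^ r) ≤
      2 ^ (r - 1) / r * ∑ i, w i * v N i ^ r := by
    linarith
  have h2 := mul_le_mul_of_nonneg_left h1 (show 0 ≤ 2 * r / (r - 1) by positivity)
  have e1 : 2 * r / (r - 1) * ((r - 1) / (2 * r) * runningMaxExpect w q v N (fun _ b => b ^ r)) =
      runningMaxExpect w q v N (fun _ b => b ^ r) := by field_simp
  have e2 : 2 * r / (r - 1) * (2 ^ (r - 1) / r * ∑ i, w i * v N i ^ r) =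
      2 ^ r / (r - 1) * ∑ i, w i * v N i ^ r := by
    rw [Real.rpow_sub_one two_ne_zero]; field_simp
  linarith

/-- The maximal inequality for the even powers of a symmetric sub-Markov matrix. -/
theorem sum_maximal_le (h : IsSubMarkovMatrix w q) {r : ℝ} (hr : 1 < r) (f : ι → ℝ) (N : ℕ)
    (κ : ι → ℕ) (hκ : ∀ i, κ i ≤ N) :
    ∑ i, w i * |(matrixAct q)^[2 * κ i] f i| ^ r ≤ 2 ^ r / (r - 1) * ∑ i, w i * |f i| ^ r := by
  set F : ι → ℝ := fun i => |f i| with hF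
  have hF0 : ∀ i, 0 ≤ F i := fun i => abs_nonneg _
  set v : ℕ → ι → ℝ := fun k => (matrixAct q)^[N - k] F with hv
  have hv0 : ∀ k i, 0 ≤ v k i := fun k => h.iterate_nonneg hF0 _
  have hstep : ∀ k < N, v k = matrixAct q (v (k + 1)) := by
    intro k hk
    simp only [hv]
    rw [← Function.iterate_succ_apply' (matrixAct q), show (N - (k + 1)).succ = N - k by omega]
  have hvN : v N = F := by simp [hv]
  set M : ι → ℝ := fun i => (matrixAct q)^[2 * κ i] F i with hM
  have hM0 : ∀ i, 0 ≤ M i := fun i => h.iterate_nonneg hF0 _ i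
  -- Linearization: the maximal function is tested against `M ^ (r - 1)`, split according to the
  -- time `κ i` chosen at each state.
  set g : ℕ → ι → ℝ := fun j i => if κ i = j then M i ^ (r - 1) else 0 with hg
  have hg0 : ∀ j i, 0 ≤ g j i := fun j i => by
    simp only [hg]; split_ifs; exacts [Real.rpow_nonneg (hM0 i) _, le_rfl]
  have hgs : ∀ i, ∑ j ∈ Finset.range (N + 1), g j i = M i ^ (r - 1) := fun i => by
    simp only [hg]
    rw [Finset.sum_ite_eq, if_pos (Finset.mem_range.2 (Nat.lt_succ_of_le (hκ i)))]
  have hr0 : 0 < r := by linarith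
  have h1 : ∑ i, w i * M i ^ r ≤ runningMaxExpect w q v N (fun i b => M i ^ (r - 1) * b) := by
    have e1 : runningMaxExpect w q v N (fun i b => M i ^ (r - 1) * b) =
        ∑ j ∈ Finset.range (N + 1), runningMaxExpect w q v N (fun i b => g j i * b) := by
      rw [← runningMaxExpect_sum]
      simp only [← Finset.sum_mul, hgs]
    have e2 : ∑ i, w i * M i ^ r = ∑ j ∈ Finset.range (N + 1),
        ∑ i, w i * g j i * (matrixAct q)^[j] (v (N - j)) i := by
      rw [Finset.sum_comm]
      refine Finset.sum_congr rfl fun i _ => ?_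
      have : ∀ j ∈ Finset.range (N + 1), w i * g j i * (matrixAct q)^[j] (v (N - j)) i =
          w i * g j i * M i := by
        intro j hj
        by_cases hij : κ i = j
        · have hjN : j ≤ N := Nat.lt_succ_iff.1 (Finset.mem_range.1 hj)
          simp only [hv, hM]
          rw [← Function.iterate_add_apply, Nat.sub_sub_self hjN, hij, two_mul]
        · simp [hg, hij]
      rw [Finset.sum_congr rfl this, ← Finset.sum_mul, ← Finset.mul_sum, hgs, mul_assoc,
        ← Real.rpow_add_one' (hM0 i) (by linarith), sub_add_cancel]
    rw [e1, e2]
    exact Finset.sum_le_sum fun j hj => h.sum_le_runningMaxExpect hv0 N _ (hg0 j) j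
      (Nat.lt_succ_iff.1 (Finset.mem_range.1 hj))
  have h2 : runningMaxExpect w q v N (fun i b => M i ^ (r - 1) * b) ≤
      (r - 1) / r * ∑ i, w i * M i ^ r + 1 / r * runningMaxExpect w q v N (fun _ b => b ^ r) := by
    have e : (r - 1) / r * ∑ i, w i * M i ^ r = ∑ i, w i * ((r - 1) / r * M i ^ r) := by
      rw [Finset.mul_sum]; exact Finset.sum_congr rfl fun i _ => by ring
    rw [e, ← h.runningMaxExpect_const (v := v) N fun i => (r - 1) / r * M i ^ r,
      ← runningMaxExpect_mul, ← runningMaxExpect_add]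
    refine h.runningMaxExpect_mono N fun i b hb => ?_
    have := rpow_sub_one_mul_le hr (hM0 i) ((hv0 N i).trans hb)
    rwa [one_div_mul_eq_div]
  have h3 := h.runningMaxExpect_rpow_le hv0 hstep hr
  rw [hvN] at h3
  -- The sum of `M ^ r` on the right of Young's inequality is absorbed on the left; it is finite
  -- because the state space is.
  have h4 : ∑ i, w i * M i ^ r ≤ runningMaxExpect w q v N (fun _ b => b ^ r) := by
    have e : (r - 1) / r = 1 - 1 / r := by field_simp
    have h5 := h1.trans h2
    rw [e] at h5
    have : 1 / r * ∑ i, w i * M i ^ r ≤ 1 / r * runningMaxExpect w q v N (fun _ b => b ^ r) := by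
      linarith
    exact le_of_mul_le_mul_left this (by positivity)
  refine le_trans (Finset.sum_le_sum fun i _ => ?_) (h4.trans h3)
  exact mul_le_mul_of_nonneg_left (Real.rpow_le_rpow (abs_nonneg _) (h.abs_iterate_le f _ i) hr0.le)
    (h.weight_nonneg i)

end IsSubMarkovMatrix

/-! ### Compression of operators to step functions -/

/-- A finite family of pairwise disjoint measurable sets of positive finite measure. -/
structure FinitePartition {E : Type*} [MeasurableSpace E] (m : Measure E) (ι : Type*) where
  /-- the cells -/
  cell : ι → Set E
  measurableSet : ∀ i, MeasurableSet (cell i)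
  disjoint : Pairwise (Function.onFun Disjoint cell)
  ne_zero : ∀ i, m (cell i) ≠ 0
  ne_top : ∀ i, m (cell i) ≠ ∞

namespace FinitePartition

variable {E : Type*} [MeasurableSpace E] {m : Measure E} {ι : Type*} (π : FinitePartition m ι)

/-- The measure of a cell. -/
noncomputable def weight (i : ι) : ℝ := m.real (π.cell i)

/-- The indicator of a cell. -/
noncomputable def ind (i : ι) : Lp ℝ 2 m := indicatorConstLp 2 (π.measurableSet i) (π.ne_top i) 1

/-- The mean of a function over a cell. -/
noncomputable def avg (f : Lp ℝ 2 m) (i : ι) : ℝ := inner ℝ (π.ind i) f / π.weight i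

theorem weight_pos (i : ι) : 0 < π.weight i := ENNReal.toReal_pos (π.ne_zero i) (π.ne_top i)

theorem inner_ind (i : ι) (f : Lp ℝ 2 m) : inner ℝ (π.ind i) f = ∫ x in π.cell i, f x ∂m :=
  L2.inner_indicatorConstLp_one _ _ f

theorem inner_ind_ind [DecidableEq ι] (i j : ι) :
    inner ℝ (π.ind i) (π.ind j) = if i = j then π.weight i else 0 := by
  rw [ind, ind, L2.real_inner_indicatorConstLp_one_indicatorConstLp_one (π.measurableSet i)
    (π.measurableSet j) (π.ne_top i) (π.ne_top j)]
  split_ifs with h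
  · subst h; rw [inter_self, weight]
  · rw [(π.disjoint h).inter_eq]; simp

theorem avg_sub (f g : Lp ℝ 2 m) : π.avg f - π.avg g = π.avg (f - g) := by
  ext i; simp only [avg, inner_sub_right, sub_div, Pi.sub_apply]

variable [Fintype ι]

/-- The function that is constant on the cells, with the given values, and vanishes outside. -/
noncomputable def embed (a : ι → ℝ) : Lp ℝ 2 m := ∑ i, a i • π.ind i

theorem ae_embed (a : ι → ℝ) : ∀ᵐ x ∂m, (∀ i, x ∈ π.cell i → π.embed a x = a i) ∧
    ((∀ i, x ∉ π.cell i) → π.embed a x = 0) := by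
  classical
  have h1 : ∀ i, ∀ᵐ x ∂m, (a i • π.ind i) x = (π.cell i).indicator (fun _ => a i) x := by
    intro i
    filter_upwards [Lp.coeFn_smul (a i) (π.ind i), indicatorConstLp_coeFn (p := 2) (μ := m)
      (hs := π.measurableSet i) (hμs := π.ne_top i) (c := (1 : ℝ))] with x e1 e2
    rw [e1, Pi.smul_apply, ind, e2]
    by_cases hx : x ∈ π.cell i <;> simp [hx]
  have h2 : π.embed a =ᵐ[m] ∑ i, ⇑(a i • π.ind i) := Lp.coeFn_finsetSum _ _
  filter_upwards [h2, ae_all_iff.2 h1] with x e1 e2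
  rw [e1, Finset.sum_apply]
  simp only [e2]
  refine ⟨fun i hi => ?_, fun h => Finset.sum_eq_zero fun i _ => indicator_of_notMem (h i) _⟩
  rw [Finset.sum_eq_single i, indicator_of_mem hi]
  · intro j _ hj
    exact indicator_of_notMem (fun hx => (disjoint_left.1 (π.disjoint hj)) hx hi) _
  · simp

theorem inner_embed_right (f : Lp ℝ 2 m) (a : ι → ℝ) :
    inner ℝ f (π.embed a) = ∑ i, π.weight i * π.avg f i * a i := by
  rw [embed, inner_sum]
  refine Finset.sum_congr rfl fun i _ => ?_
  rw [inner_smul_right, real_inner_comm, avg]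
  have := (π.weight_pos i).ne'
  field_simp

theorem avg_embed (a : ι → ℝ) : π.avg (π.embed a) = a := by
  classical
  ext i
  rw [avg, embed, inner_sum]
  simp only [inner_smul_right, π.inner_ind_ind]
  have := (π.weight_pos i).ne'
  simp [this]

theorem norm_embed_avg_le (f : Lp ℝ 2 m) : ‖π.embed (π.avg f)‖ ≤ ‖f‖ := by
  have h1 : ‖π.embed (π.avg f)‖ ^ 2 = inner ℝ f (π.embed (π.avg f)) := by
    rw [← real_inner_self_eq_norm_sq, π.inner_embed_right, π.inner_embed_right, π.avg_embed]
  have h2 := real_inner_le_norm f (π.embed (π.avg f))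
  rcases (norm_nonneg (π.embed (π.avg f))).eq_or_lt with h | h
  · rw [← h]; exact norm_nonneg _
  · nlinarith

theorem embed_sub (a b : ι → ℝ) : π.embed a - π.embed b = π.embed (a - b) := by
  simp only [embed, ← Finset.sum_sub_distrib, ← sub_smul, Pi.sub_apply]

theorem lintegral_eq_sum {F : E → ℝ≥0∞} {c : ι → ℝ≥0∞}
    (h : ∀ᵐ x ∂m, (∀ i, x ∈ π.cell i → F x = c i) ∧ ((∀ i, x ∉ π.cell i) → F x = 0)) :
    ∫⁻ x, F x ∂m = ∑ i, c i * m (π.cell i) := by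
  have h1 : F =ᵐ[m] fun x => ∑ i, (π.cell i).indicator (fun _ => c i) x := by
    filter_upwards [h] with x hx
    by_cases hxc : ∃ i, x ∈ π.cell i
    · obtain ⟨i, hi⟩ := hxc
      rw [hx.1 i hi, Finset.sum_eq_single i, indicator_of_mem hi]
      · intro j _ hj
        exact indicator_of_notMem (fun hx => (disjoint_left.1 (π.disjoint hj)) hx hi) _
      · simp
    · push Not at hxc
      rw [hx.2 hxc, Finset.sum_eq_zero fun i _ => indicator_of_notMem (hxc i) _]
  rw [lintegral_congr_ae h1, lintegral_finsetSum _ fun i _ =>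
    measurable_const.indicator (π.measurableSet i)]
  exact Finset.sum_congr rfl fun i _ => lintegral_indicator_const (π.measurableSet i) _

/-- Jensen's inequality on each cell, in the form of Hölder against the constant one, summed over
the disjoint cells. -/
theorem sum_enorm_avg_rpow_le {r : ℝ} (hr : 1 < r) (f : Lp ℝ 2 m) :
    ∑ i, ‖π.avg f i‖ₑ ^ r * m (π.cell i) ≤ ∫⁻ x, ‖f x‖ₑ ^ r ∂m := by
  have hr0 : 0 < r := by linarith
  have hcell : ∀ i, ‖π.avg f i‖ₑ ^ r * m (π.cell i) ≤ ∫⁻ x in π.cell i, ‖f x‖ₑ ^ r ∂m := by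
    intro i
    have hm0 := π.ne_zero i
    have hmt := π.ne_top i
    have h1 : ‖∫ x in π.cell i, f x ∂m‖ₑ ≤ ∫⁻ x in π.cell i, ‖f x‖ₑ ∂m :=
      enorm_integral_le_lintegral_enorm _
    have h2 : ∫⁻ x in π.cell i, ‖f x‖ₑ ∂m ≤
        (∫⁻ x in π.cell i, ‖f x‖ₑ ^ r ∂m) ^ (1 / r) * m (π.cell i) ^ (1 - 1 / r) := by
      have h := ENNReal.lintegral_mul_norm_pow_le (μ := m.restrict (π.cell i))
        (f := fun x => ‖f x‖ₑ ^ r) (g := fun _ => 1)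
        ((Lp.aestronglyMeasurable f).enorm.pow_const r).restrict aemeasurable_const
        (p := 1 / r) (q := 1 - 1 / r) (by positivity)
        (sub_nonneg.2 ((div_le_one hr0).2 hr.le)) (by ring)
      simpa [← ENNReal.rpow_mul, hr0.ne'] using h
    have h3 : ‖π.avg f i‖ₑ = ‖∫ x in π.cell i, f x ∂m‖ₑ / m (π.cell i) := by
      rw [avg, inner_ind, div_eq_mul_inv, enorm_mul, enorm_inv (π.weight_pos i).ne', ← div_eq_mul_inv]
      congr 1
      rw [weight, Measure.real, Real.enorm_of_nonneg ENNReal.toReal_nonneg, ENNReal.ofReal_toReal hmt]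
    have h4 : ‖π.avg f i‖ₑ ^ r ≤ (∫⁻ x in π.cell i, ‖f x‖ₑ ^ r ∂m) * m (π.cell i) ^ (-1 : ℝ) := by
      have h5 : ‖π.avg f i‖ₑ ≤
          (∫⁻ x in π.cell i, ‖f x‖ₑ ^ r ∂m) ^ (1 / r) * m (π.cell i) ^ (-(1 / r)) := by
        rw [h3]
        refine (ENNReal.div_le_div_right (h1.trans h2) _).trans (le_of_eq ?_)
        rw [div_eq_mul_inv, mul_assoc, ← ENNReal.rpow_neg_one, ← ENNReal.rpow_add _ _ hm0 hmt]
        congr 2; ring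
      refine (ENNReal.rpow_le_rpow h5 hr0.le).trans (le_of_eq ?_)
      rw [ENNReal.mul_rpow_of_nonneg _ _ hr0.le, ← ENNReal.rpow_mul, ← ENNReal.rpow_mul,
        one_div_mul_cancel hr0.ne', ENNReal.rpow_one, neg_mul, one_div_mul_cancel hr0.ne']
    refine (mul_le_mul_left h4 _).trans (le_of_eq ?_)
    rw [mul_assoc, ENNReal.rpow_neg_one, ENNReal.inv_mul_cancel hm0 hmt, mul_one]
  refine (Finset.sum_le_sum fun i _ => hcell i).trans ?_
  rw [← lintegral_biUnion_finset (fun i _ j _ hij => π.disjoint hij)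
    (fun i _ => π.measurableSet i)]
  exact setLIntegral_le_lintegral _ _

/-- The matrix of an operator on `L²` compressed to the functions that are constant on the cells. -/
noncomputable def matrix (S : Lp ℝ 2 m →L[ℝ] Lp ℝ 2 m) (i j : ι) : ℝ := π.avg (S (π.ind j)) i

theorem avg_apply_embed (S : Lp ℝ 2 m →L[ℝ] Lp ℝ 2 m) (a : ι → ℝ) :
    π.avg (S (π.embed a)) = matrixAct (π.matrix S) a := by
  ext i
  simp only [avg, embed, matrixAct, matrix, map_sum, map_smul, inner_sum, inner_smul_right,
    Finset.sum_div]
  exact Finset.sum_congr rfl fun j _ => by ring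

theorem isSubMarkovMatrix {S : Lp ℝ 2 m →L[ℝ] Lp ℝ 2 m} (hS : IsSubMarkov S)
    (hsymm : ∀ f g, inner ℝ (S f) g = inner ℝ f (S g)) :
    IsSubMarkovMatrix π.weight (π.matrix S) := by
  have hw : ∀ i f, π.weight i * π.avg f i = inner ℝ (π.ind i) f := fun i f => by
    have := (π.weight_pos i).ne'
    rw [avg]; field_simp
  refine ⟨fun i => (π.weight_pos i).le, fun i j => ?_, fun i => ?_, fun i j => ?_⟩
  · refine div_nonneg ?_ (π.weight_pos i).le
    rw [inner_ind]
    have h := hS (π.ind j) (by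
      filter_upwards [indicatorConstLp_coeFn (p := 2) (μ := m)
        (hs := π.measurableSet j) (hμs := π.ne_top j) (c := (1 : ℝ))] with x hx
      rw [ind, hx]
      by_cases hx : x ∈ π.cell j <;> simp [hx])
    exact setIntegral_nonneg_of_ae_restrict (ae_restrict_of_ae (h.mono fun x hx => hx.1))
  · have h := hS (π.embed fun _ => 1) (by
      filter_upwards [π.ae_embed fun _ => 1] with x hx
      by_cases hxc : ∃ i, x ∈ π.cell i
      · obtain ⟨i, hi⟩ := hxc
        simp [hx.1 i hi]
      · push Not at hxc
        simp [hx.2 hxc])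
    have h1 : ∑ j, π.matrix S i j = π.avg (S (π.embed fun _ => 1)) i := by
      rw [π.avg_apply_embed]; simp [matrixAct]
    rw [h1, avg, div_le_one (π.weight_pos i), inner_ind]
    have h2 : ∫ x in π.cell i, S (π.embed fun _ => 1) x ∂m ≤ ∫ x in π.cell i, (1 : ℝ) ∂m := by
      refine setIntegral_mono_ae (integrableOn_Lp_of_measure_ne_top _
        fact_one_le_two_ennreal.elim (π.ne_top i)) (integrableOn_const (π.ne_top i)) ?_
      exact h.mono fun x hx => hx.2
    refine h2.trans (le_of_eq ?_)
    simp [weight]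
  · rw [matrix, matrix, hw, hw, ← hsymm, real_inner_comm]

/-- Both `S` and the averaging projection are contractions, so the projection errors along the orbit
of `f` merely add up: one for the initial function and one for each step. -/
theorem norm_embed_iterate_sub_le (S : Lp ℝ 2 m →L[ℝ] Lp ℝ 2 m) (hc : ∀ f, ‖S f‖ ≤ ‖f‖)
    (f : Lp ℝ 2 m) {ε : ℝ} {n : ℕ}
    (h : ∀ k ≤ n, ‖π.embed (π.avg (S^[k] f)) - S^[k] f‖ ≤ ε) :
    ‖π.embed ((matrixAct (π.matrix S))^[n] (π.avg f)) - S^[n] f‖ ≤ (n + 1) * ε := by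
  induction n with
  | zero => simpa using h 0 le_rfl
  | succ n ih =>
    have ih' := ih fun k hk => h k (hk.trans n.le_succ)
    have hn := h (n + 1) le_rfl
    rw [Function.iterate_succ_apply' (matrixAct (π.matrix S)), ← π.avg_apply_embed]
    set g := π.embed ((matrixAct (π.matrix S))^[n] (π.avg f))
    have e : π.embed (π.avg (S g)) - S^[n + 1] f = π.embed (π.avg (S (g - S^[n] f))) +
        (π.embed (π.avg (S^[n + 1] f)) - S^[n + 1] f) := by
      rw [map_sub, ← π.avg_sub, ← π.embed_sub, ← Function.iterate_succ_apply' S]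
      abel
    rw [e]
    refine (norm_add_le _ _).trans ?_
    have := (π.norm_embed_avg_le (S (g - S^[n] f))).trans ((hc _).trans ih')
    push_cast
    linarith

/-- Finitely many functions of `L²` are approximated by their means over the cells of a suitable
partition. -/
theorem exists_norm_embed_avg_sub_le {n : ℕ} (f : Fin n → Lp ℝ 2 m) {ε : ℝ} (hε : 0 < ε) :
    ∃ (ι : Type) (_ : Fintype ι) (π : FinitePartition m ι),
      ∀ k, ‖π.embed (π.avg (f k)) - f k‖ ≤ ε := by
  have hsimple : ∀ k, ∃ g : SimpleFunc E ℝ,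
      eLpNorm (⇑(f k) - ⇑g) 2 m < ENNReal.ofReal (ε / 2) ∧ MemLp g 2 m :=
    fun k => (Lp.memLp (f k)).exists_simpleFunc_eLpNorm_sub_lt ENNReal.ofNat_ne_top
      (by simpa using hε)
  choose g hg hgm using hsimple
  set s : E → Fin n → ℝ := fun x k => g k x with hs
  have hsm : Measurable s := measurable_pi_lambda _ fun k => (g k).measurable
  have hsf : (range s).Finite := by
    refine (Set.Finite.pi' fun k => (g k).finite_range).subset ?_
    rintro _ ⟨x, rfl⟩ k
    exact ⟨x, rfl⟩
  -- The cells are the joint level sets of the simple functions. The zero vector is dropped because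
  -- its level set may have infinite measure; every other level set lies in one where some `g k` is
  -- non-zero, which is finite. Null level sets are dropped so that averages make sense.
  set T : Set (Fin n → ℝ) := {c | c ∈ range s ∧ c ≠ 0 ∧ m (s ⁻¹' {c}) ≠ 0} with hT
  have hTf : T.Finite := hsf.subset fun c hc => hc.1
  let π : FinitePartition m T :=
    { cell := fun c => s ⁻¹' {c.1}
      measurableSet := fun c => hsm (measurableSet_singleton _)
      disjoint := fun c d hcd => by
        refine disjoint_left.2 fun x hx hy => hcd (Subtype.ext ?_)
        rw [mem_preimage, mem_singleton_iff] at hx hy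
        exact hx.symm.trans hy
      ne_zero := fun c => c.2.2.2
      ne_top := fun c => by
        obtain ⟨k, hk⟩ : ∃ k, c.1 k ≠ 0 := by
          by_contra hcon
          push Not at hcon
          exact c.2.2.1 (funext hcon)
        refine ne_top_of_le_ne_top (SimpleFunc.measure_preimage_lt_top_of_memLp two_ne_zero
          ENNReal.ofNat_ne_top (g k) (hgm k) (c.1 k) hk).ne (measure_mono fun x hx => ?_)
        rw [mem_preimage, mem_singleton_iff] at hx ⊢
        rw [← hx] }
  have := hTf.fintype
  refine ⟨T, inferInstance, π, fun k => ?_⟩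
  have hnull : ∀ᵐ x ∂m, s x ∈ T ∨ s x = 0 := by
    have h1 : ∀ᵐ x ∂m, ∀ c ∈ range s, m (s ⁻¹' {c}) = 0 → s x ≠ c := by
      refine (ae_ball_iff hsf.countable).2 fun c hc => ?_
      by_cases h0 : m (s ⁻¹' {c}) = 0
      · filter_upwards [compl_mem_ae_iff.2 h0] with x hx _ using hx
      · exact Eventually.of_forall fun x h => absurd h h0
    filter_upwards [h1] with x hx
    by_cases h0 : s x = 0
    · exact Or.inr h0
    · exact Or.inl ⟨⟨x, rfl⟩, h0, fun h => hx _ ⟨x, rfl⟩ h rfl⟩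
  have hemb : (hgm k).toLp (g k) = π.embed fun c => c.1 k := by
    refine Lp.ext ?_
    filter_upwards [(hgm k).coeFn_toLp, π.ae_embed fun c => c.1 k, hnull] with x e1 e2 e3
    rw [e1]
    rcases e3 with h | h
    · exact (e2.1 ⟨s x, h⟩ rfl).symm
    · rw [e2.2 fun c hc => c.2.2.1 (Eq.trans (Eq.symm hc) h)]
      exact congrFun h k
  have hdist : ‖f k - (hgm k).toLp (g k)‖ ≤ ε / 2 := by
    have : f k - (hgm k).toLp (g k) = ((Lp.memLp (f k)).sub (hgm k)).toLp _ := by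
      rw [MemLp.toLp_sub (Lp.memLp (f k)) (hgm k), Lp.toLp_coeFn]
    rw [this, Lp.norm_toLp]
    refine (ENNReal.toReal_mono ENNReal.ofReal_ne_top (hg k).le).trans ?_
    rw [ENNReal.toReal_ofReal (by positivity)]
  -- The projection fixes the simple function, so its error on `f k` is its error on the difference,
  -- at most twice the norm `ε / 2`.
  have e : π.embed (π.avg (f k)) - f k = π.embed (π.avg (f k - (hgm k).toLp (g k))) -
      (f k - (hgm k).toLp (g k)) := by
    rw [← π.avg_sub, ← π.embed_sub, hemb, π.avg_embed]
    abel
  rw [e]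
  refine (norm_sub_le _ _).trans ?_
  have := π.norm_embed_avg_le (f k - (hgm k).toLp (g k))
  linarith

end FinitePartition

/-! ### Almost everywhere convergence from summable errors -/

section Convergence

variable {E : Type*} [MeasurableSpace E] {m : Measure E}

theorem ae_tendsto_of_tsum_lintegral_ne_top {r : ℝ} (hr : 0 < r) {g : ℕ → E → ℝ} {f : E → ℝ}
    (hg : ∀ k, AEStronglyMeasurable (g k) m) (hf : AEStronglyMeasurable f m)
    (h : ∑' k, ∫⁻ x, ‖g k x - f x‖ₑ ^ r ∂m ≠ ∞) :
    ∀ᵐ x ∂m, Tendsto (fun k => g k x) atTop (𝓝 (f x)) := by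
  have hmeas : ∀ k, AEMeasurable (fun x => ‖g k x - f x‖ₑ ^ r) m :=
    fun k => (((hg k).sub hf).enorm).pow_const r
  rw [← lintegral_tsum hmeas] at h
  filter_upwards [ae_lt_top' (AEMeasurable.tsum hmeas) h] with x hx
  have h1 := ENNReal.tendsto_atTop_zero_of_tsum_ne_top hx.ne
  have h2 : Tendsto (fun k => (‖g k x - f x‖ₑ ^ r) ^ (1 / r)) atTop (𝓝 (0 ^ (1 / r))) :=
    h1.ennrpow_const (1 / r)
  rw [ENNReal.zero_rpow_of_pos (by positivity)] at h2
  simp only [← ENNReal.rpow_mul, mul_one_div_cancel hr.ne', ENNReal.rpow_one] at h2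
  rw [tendsto_iff_edist_tendsto_0]
  simpa only [edist_eq_enorm_sub] using h2

theorem lintegral_enorm_sq (u : Lp ℝ 2 m) :
    ∫⁻ x, ‖u x‖ₑ ^ (2 : ℝ) ∂m = ENNReal.ofReal (‖u‖ ^ 2) := by
  have h := eLpNorm_eq_lintegral_rpow_enorm_toReal (f := u) (μ := m) (p := 2) two_ne_zero
    ENNReal.ofNat_ne_top
  simp only [ENNReal.toReal_ofNat] at h
  rw [Lp.norm_def, ← ENNReal.toReal_pow, ENNReal.ofReal_toReal (by finiteness [Lp.eLpNorm_ne_top u]),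
    ← ENNReal.rpow_natCast, h, ← ENNReal.rpow_mul]
  norm_num

theorem ae_tendsto_of_norm_sub_le {g : ℕ → Lp ℝ 2 m} {f : Lp ℝ 2 m} {C : ℝ}
    (h : ∀ k, ‖g k - f‖ ≤ C * (1 / 2) ^ k) :
    ∀ᵐ x ∂m, Tendsto (fun k => g k x) atTop (𝓝 (f x)) := by
  refine ae_tendsto_of_tsum_lintegral_ne_top two_pos (fun k => Lp.aestronglyMeasurable _)
    (Lp.aestronglyMeasurable _) ?_
  have h1 : ∀ k, ∫⁻ x, ‖g k x - f x‖ₑ ^ (2 : ℝ) ∂m ≤ ENNReal.ofReal (C ^ 2 * (1 / 4) ^ k) := by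
    intro k
    have e : ∫⁻ x, ‖g k x - f x‖ₑ ^ (2 : ℝ) ∂m = ∫⁻ x, ‖(g k - f) x‖ₑ ^ (2 : ℝ) ∂m := by
      refine lintegral_congr_ae ?_
      filter_upwards [Lp.coeFn_sub (g k) f] with x hx
      rw [hx, Pi.sub_apply]
    rw [e, lintegral_enorm_sq]
    refine ENNReal.ofReal_le_ofReal ?_
    calc ‖g k - f‖ ^ 2 ≤ (C * (1 / 2) ^ k) ^ 2 := pow_le_pow_left₀ (norm_nonneg _) (h k) 2
      _ = C ^ 2 * (1 / 4) ^ k := by rw [mul_pow, ← pow_mul, mul_comm k, pow_mul]; norm_num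
  refine ne_top_of_le_ne_top ?_ (ENNReal.tsum_le_tsum h1)
  have hs : Summable fun k : ℕ => C ^ 2 * (1 / 4 : ℝ) ^ k :=
    (summable_geometric_of_lt_one (by norm_num) (by norm_num)).mul_left _
  rw [← ENNReal.ofReal_tsum_of_nonneg (fun k => by positivity) hs]
  exact ENNReal.ofReal_ne_top

end Convergence

/-! ### Normal contractions and the form domain -/

namespace IsSubMarkovMatrix

variable {ι : Type*} [Fintype ι] {w : ι → ℝ} {q : ι → ι → ℝ}

/-- The finite Beurling–Deny decomposition into a jump part and a killing part. Both have
non-negative coefficients, so Lipschitz maps fixing zero act term by term. -/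
theorem energy_eq (h : IsSubMarkovMatrix w q) (a : ι → ℝ) :
    ∑ i, w i * a i * a i - ∑ i, w i * matrixAct q a i * a i =
      ∑ i, ∑ j, w i * q i j * (a i - a j) ^ 2 / 2 + ∑ i, w i * (1 - ∑ j, q i j) * a i ^ 2 := by
  have h1 : ∑ i, ∑ j, w i * q i j * a j ^ 2 = ∑ i, ∑ j, w i * q i j * a i ^ 2 := by
    rw [Finset.sum_comm]
    exact Finset.sum_congr rfl fun i _ => Finset.sum_congr rfl fun j _ => by rw [h.symm]
  have h2 : ∑ i, ∑ j, w i * q i j * (a i - a j) ^ 2 / 2 =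
      (∑ i, ∑ j, w i * q i j * a i ^ 2) / 2 + (∑ i, ∑ j, w i * q i j * a j ^ 2) / 2 -
        ∑ i, w i * matrixAct q a i * a i := by
    simp only [matrixAct, Finset.sum_div, Finset.mul_sum, Finset.sum_mul, ← Finset.sum_add_distrib,
      ← Finset.sum_sub_distrib]
    exact Finset.sum_congr rfl fun i _ => Finset.sum_congr rfl fun j _ => by ring
  have h3 : ∑ i, w i * (1 - ∑ j, q i j) * a i ^ 2 =
      ∑ i, w i * a i * a i - ∑ i, ∑ j, w i * q i j * a i ^ 2 := by
    rw [← Finset.sum_sub_distrib]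
    refine Finset.sum_congr rfl fun i _ => ?_
    rw [← Finset.sum_mul, ← Finset.mul_sum]; ring
  rw [h2, h3, h1]; ring

theorem energy_comp_le (h : IsSubMarkovMatrix w q) {ψ : ℝ → ℝ} {L : ℝ≥0} (hψ : LipschitzWith L ψ)
    (h0 : ψ 0 = 0) (a : ι → ℝ) :
    ∑ i, w i * ψ (a i) * ψ (a i) - ∑ i, w i * matrixAct q (fun i => ψ (a i)) i * ψ (a i) ≤
      L ^ 2 * (∑ i, w i * a i * a i - ∑ i, w i * matrixAct q a i * a i) := by
  have hsq : ∀ x y, (ψ x - ψ y) ^ 2 ≤ L ^ 2 * (x - y) ^ 2 := fun x y => by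
    have := hψ.dist_le_mul x y
    rw [Real.dist_eq, Real.dist_eq] at this
    rw [← sq_abs, ← sq_abs (x - y), ← mul_pow]
    exact pow_le_pow_left₀ (abs_nonneg _) this 2
  rw [h.energy_eq a, h.energy_eq fun i => ψ (a i), mul_add, Finset.mul_sum, Finset.mul_sum]
  refine add_le_add (Finset.sum_le_sum fun i _ => ?_) (Finset.sum_le_sum fun i _ => ?_)
  · rw [Finset.mul_sum]
    refine Finset.sum_le_sum fun j _ => ?_
    have := mul_le_mul_of_nonneg_left (hsq (a i) (a j))
      (mul_nonneg (h.weight_nonneg i) (h.nonneg i j))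
    linarith
  · have := mul_le_mul_of_nonneg_left (hsq (a i) 0) (h.birth_nonneg i)
    rw [h0, sub_zero, sub_zero] at this
    linarith

end IsSubMarkovMatrix

section Contraction

variable {E : Type*} [MeasurableSpace E] {m : Measure E}

theorem FinitePartition.compLp_embed {ι : Type*} [Fintype ι] (π : FinitePartition m ι)
    {ψ : ℝ → ℝ} {L : ℝ≥0} (hψ : LipschitzWith L ψ) (h0 : ψ 0 = 0) (a : ι → ℝ) :
    hψ.compLp h0 (π.embed a) = π.embed fun i => ψ (a i) := by
  refine Lp.ext ?_
  filter_upwards [hψ.coeFn_compLp h0 (π.embed a), π.ae_embed a, π.ae_embed fun i => ψ (a i)]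
    with x e1 e2 e3
  rw [e1, Function.comp_apply]
  by_cases hxc : ∃ i, x ∈ π.cell i
  · obtain ⟨i, hi⟩ := hxc
    rw [e2.1 i hi, e3.1 i hi]
  · push Not at hxc
    rw [e2.2 hxc, e3.2 hxc, h0]

/-- Normal contractions reduce the approximating form of a symmetric sub-Markovian operator. -/
theorem IsSubMarkov.inner_compLp_le {S : Lp ℝ 2 m →L[ℝ] Lp ℝ 2 m} (hS : IsSubMarkov S)
    (hsymm : ∀ f g, inner ℝ (S f) g = inner ℝ f (S g))
    {ψ : ℝ → ℝ} {L : ℝ≥0} (hψ : LipschitzWith L ψ) (h0 : ψ 0 = 0) (u : Lp ℝ 2 m) :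
    inner ℝ (hψ.compLp h0 u - S (hψ.compLp h0 u)) (hψ.compLp h0 u) ≤
      L ^ 2 * inner ℝ (u - S u) u := by
  -- Both sides are continuous in `u`, so it is enough to treat step functions, where the claim is
  -- the matrix inequality.
  have hclosed : IsClosed {u : Lp ℝ 2 m |
      inner ℝ (hψ.compLp h0 u - S (hψ.compLp h0 u)) (hψ.compLp h0 u) ≤
        L ^ 2 * inner ℝ (u - S u) u} := by
    have hc : Continuous fun u : Lp ℝ 2 m => hψ.compLp h0 u := hψ.continuous_compLp h0
    refine isClosed_le ?_ ?_ <;> fun_prop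
  refine hclosed.closure_subset (Metric.mem_closure_iff.2 fun ε hε => ?_)
  obtain ⟨ι, _, π, hπ⟩ := FinitePartition.exists_norm_embed_avg_sub_le (m := m) (n := 1)
    (fun _ => u) (half_pos hε)
  refine ⟨π.embed (π.avg u), ?_, ?_⟩
  · have key : ∀ a : ι → ℝ, inner ℝ (π.embed a - S (π.embed a)) (π.embed a) =
        ∑ i, π.weight i * a i * a i - ∑ i, π.weight i * matrixAct (π.matrix S) a i * a i := by
      intro a
      rw [inner_sub_left, π.inner_embed_right, π.inner_embed_right, π.avg_embed, π.avg_apply_embed]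
    rw [mem_ofPred_eq, π.compLp_embed hψ h0, key, key]
    exact (π.isSubMarkovMatrix hS hsymm).energy_comp_le hψ h0 _
  · rw [dist_comm, dist_eq_norm]
    exact (hπ 0).trans_lt (half_lt_self hε)

theorem DirichletForm.IsSemigroup.grad_mem_domain {𝓔 : DirichletForm m}
    {P : ℝ → Lp ℝ 2 m →L[ℝ] Lp ℝ 2 m} (hP : 𝓔.IsSemigroup P) {φ ψ : ℝ → ℝ} {L : ℝ≥0}
    (h : IsConvexPotential φ ψ L) (u : 𝓔.domain) : h.grad (u : Lp ℝ 2 m) ∈ 𝓔.domain := by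
  refine hP.mem_domain_of_bound (C := L ^ 2 * 𝓔.form u u) fun t ht => ?_
  have h1 := (hP.isSubMarkov ht.le).inner_compLp_le (hP.symm t ht.le) h.lipschitz h.deriv_zero
    (u : Lp ℝ 2 m)
  calc 1 / t * inner ℝ (h.grad (u : Lp ℝ 2 m) - P t (h.grad (u : Lp ℝ 2 m))) (h.grad (u : Lp ℝ 2 m))
      ≤ 1 / t * (L ^ 2 * inner ℝ ((u : Lp ℝ 2 m) - P t u) (u : Lp ℝ 2 m)) :=
        mul_le_mul_of_nonneg_left h1 (by positivity)
    _ = L ^ 2 * (1 / t * inner ℝ ((u : Lp ℝ 2 m) - P t u) (u : Lp ℝ 2 m)) := by ring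
    _ ≤ _ := mul_le_mul_of_nonneg_left (hP.approx_le_form u ht) (by positivity)

end Contraction

/-! ### The maximal theorem on `L²` -/

section Maximal

variable {E : Type*} [MeasurableSpace E] {m : Measure E}

theorem FinitePartition.lintegral_iSup_le {ι : Type*} [Fintype ι] (π : FinitePartition m ι)
    {q : ι → ι → ℝ} (hq : IsSubMarkovMatrix π.weight q) {r : ℝ} (hr : 1 < r) (f : Lp ℝ 2 m)
    (N : ℕ) :
    ∫⁻ x, ⨆ n : Fin (N + 1), ‖π.embed ((matrixAct q)^[2 * n] (π.avg f)) x‖ₑ ^ r ∂m ≤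
      ENNReal.ofReal (2 ^ r / (r - 1)) * ∫⁻ x, ‖f x‖ₑ ^ r ∂m := by
  have hr0 : 0 < r := by linarith
  set a : ℕ → ι → ℝ := fun n => (matrixAct q)^[2 * n] (π.avg f) with ha
  rw [π.lintegral_eq_sum (c := fun i => ⨆ n : Fin (N + 1), ‖a n i‖ₑ ^ r) (by
    filter_upwards [ae_all_iff.2 fun n : Fin (N + 1) => π.ae_embed (a n)] with x hx
    refine ⟨fun i hi => iSup_congr fun n => by rw [(hx n).1 i hi], fun h => ?_⟩
    simp [(hx _).2 h, hr0, a])]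
  -- On each cell the finite supremum is attained at some index, which serves as the state-dependent
  -- time in the matrix inequality.
  have hatt : ∀ i, ∃ n : Fin (N + 1), ‖a n i‖ₑ ^ r = ⨆ n : Fin (N + 1), ‖a n i‖ₑ ^ r :=
    fun i => exists_eq_ciSup_of_finite
  choose κ hκ using hatt
  have hcell : ∀ i, m (π.cell i) = ENNReal.ofReal (π.weight i) := fun i =>
    (ENNReal.ofReal_toReal (π.ne_top i)).symm
  have hpow : ∀ (b : ℝ) i, ‖b‖ₑ ^ r * m (π.cell i) = ENNReal.ofReal (π.weight i * |b| ^ r) := by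
    intro b i
    rw [hcell, Real.enorm_eq_ofReal_abs, ENNReal.ofReal_rpow_of_nonneg (abs_nonneg _) hr0.le,
      ← ENNReal.ofReal_mul (by positivity), mul_comm]
  have hnn : ∀ (b : ℝ) i, 0 ≤ π.weight i * |b| ^ r := fun b i =>
    mul_nonneg (π.weight_pos i).le (by positivity)
  calc ∑ i, (⨆ n : Fin (N + 1), ‖a n i‖ₑ ^ r) * m (π.cell i)
      = ENNReal.ofReal (∑ i, π.weight i * |a (κ i) i| ^ r) := by
        rw [ENNReal.ofReal_sum_of_nonneg fun i _ => hnn _ i]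
        exact Finset.sum_congr rfl fun i _ => by rw [← hκ, hpow]
    _ ≤ ENNReal.ofReal (2 ^ r / (r - 1) * ∑ i, π.weight i * |π.avg f i| ^ r) :=
        ENNReal.ofReal_le_ofReal (hq.sum_maximal_le hr (π.avg f) N (fun i => κ i)
          fun i => Nat.lt_succ_iff.1 (κ i).2)
    _ = ENNReal.ofReal (2 ^ r / (r - 1)) * ∑ i, ‖π.avg f i‖ₑ ^ r * m (π.cell i) := by
        have : 0 < r - 1 := by linarith
        rw [ENNReal.ofReal_mul (by positivity), ENNReal.ofReal_sum_of_nonneg fun i _ => hnn _ i]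
        simp only [hpow]
    _ ≤ _ := by gcongr; exact π.sum_enorm_avg_rpow_le hr f

/-- The maximal inequality for the even powers of a symmetric sub-Markovian contraction of `L²`. -/
theorem IsSubMarkov.lintegral_iSup_le {S : Lp ℝ 2 m →L[ℝ] Lp ℝ 2 m} (hS : IsSubMarkov S)
    (hsymm : ∀ f g, inner ℝ (S f) g = inner ℝ f (S g)) (hc : ∀ f, ‖S f‖ ≤ ‖f‖)
    {r : ℝ} (hr : 1 < r) (f : Lp ℝ 2 m) (N : ℕ) :
    ∫⁻ x, ⨆ n : Fin (N + 1), ‖S^[2 * n] f x‖ₑ ^ r ∂m ≤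
      ENNReal.ofReal (2 ^ r / (r - 1)) * ∫⁻ x, ‖f x‖ₑ ^ r ∂m := by
  have hr0 : 0 < r := by linarith
  have hex : ∀ k : ℕ, ∃ (ι : Type) (_ : Fintype ι) (π : FinitePartition m ι),
      ∀ j : Fin (2 * N + 1), ‖π.embed (π.avg (S^[j] f)) - S^[j] f‖ ≤ (1 / 2) ^ k := fun k =>
    FinitePartition.exists_norm_embed_avg_sub_le (m := m) (fun j : Fin (2 * N + 1) => S^[j] f)
      (by positivity)
  choose ι hι π hπ using hex
  set G : ℕ → ℕ → Lp ℝ 2 m := fun n k =>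
    (π k).embed ((matrixAct ((π k).matrix S))^[2 * n] ((π k).avg f)) with hG
  -- The partitions have error `2⁻ᵏ` along the orbit, so the compressed iterates converge almost
  -- everywhere without a subsequence, ready for Fatou's lemma.
  have hlim : ∀ n : Fin (N + 1), ∀ᵐ x ∂m,
      Tendsto (fun k => G n k x) atTop (𝓝 (S^[2 * n] f x)) := fun n => by
    have hn : (n : ℕ) ≤ N := Nat.lt_succ_iff.1 n.2
    refine ae_tendsto_of_norm_sub_le (C := ((2 * n : ℕ) : ℝ) + 1) fun k => ?_
    refine (π k).norm_embed_iterate_sub_le S hc f fun j hj => ?_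
    exact hπ k ⟨j, by omega⟩
  calc ∫⁻ x, ⨆ n : Fin (N + 1), ‖S^[2 * n] f x‖ₑ ^ r ∂m
      ≤ ∫⁻ x, liminf (fun k => ⨆ n : Fin (N + 1), ‖G n k x‖ₑ ^ r) atTop ∂m := by
        refine lintegral_mono_ae ?_
        filter_upwards [ae_all_iff.2 hlim] with x hx
        refine iSup_le fun n => ?_
        have h1 : Tendsto (fun k => ‖G n k x‖ₑ ^ r) atTop (𝓝 (‖S^[2 * n] f x‖ₑ ^ r)) :=
          ((hx n).enorm).ennrpow_const r
        rw [← h1.liminf_eq]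
        exact liminf_le_liminf (Eventually.of_forall fun k =>
          le_iSup (fun n : Fin (N + 1) => ‖G n k x‖ₑ ^ r) n)
    _ ≤ liminf (fun k => ∫⁻ x, ⨆ n : Fin (N + 1), ‖G n k x‖ₑ ^ r ∂m) atTop :=
        lintegral_liminf_le' fun k => AEMeasurable.iSup fun n =>
          (Lp.aestronglyMeasurable (G n k)).enorm.pow_const r
    _ ≤ liminf (fun _ : ℕ => ENNReal.ofReal (2 ^ r / (r - 1)) * ∫⁻ x, ‖f x‖ₑ ^ r ∂m) atTop :=
        liminf_le_liminf (Eventually.of_forall fun k =>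
          (π k).lintegral_iSup_le ((π k).isSubMarkovMatrix hS hsymm) hr f N)
    _ = _ := by simp

variable {𝓔 : DirichletForm m} {P : ℝ → Lp ℝ 2 m →L[ℝ] Lp ℝ 2 m}

theorem DirichletForm.IsSemigroup.iterate (hP : 𝓔.IsSemigroup P) {δ : ℝ} (hδ : 0 ≤ δ)
    (f : Lp ℝ 2 m) (n : ℕ) : (P δ)^[n] f = P (n * δ) f := by
  induction n with
  | zero => simp [hP.zero]
  | succ n ih =>
    rw [Function.iterate_succ_apply', ih, ← hP.add _ _ hδ (by positivity)]
    congr 2; push_cast; ring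

/-- The maximal theorem for the semigroup of a Dirichlet form. -/
theorem DirichletForm.IsSemigroup.exists_maximal (hP : 𝓔.IsSemigroup P) {r : ℝ} (hr : 1 < r)
    (f : Lp ℝ 2 m) :
    ∃ w : E → ℝ≥0∞, Measurable w ∧ (∀ t > 0, ∀ᵐ x ∂m, ‖P t f x‖ₑ ^ r ≤ w x) ∧
      ∫⁻ x, w x ∂m ≤ ENNReal.ofReal (2 ^ r / (r - 1)) * ∫⁻ x, ‖f x‖ₑ ^ r ∂m := by
  -- Level `K` uses mesh `2⁻ᴷ` on `[0, 2ᴷ]`, hence `4ᴷ` steps; the grids are nested, so `W`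
  -- increases with `K`.
  set W : ℕ → E → ℝ≥0∞ := fun K x =>
    ⨆ n : Fin (4 ^ K + 1), ‖P (n / 2 ^ K) f x‖ₑ ^ r with hW
  have hWm : ∀ K, Measurable (W K) := fun K => Measurable.iSup fun n =>
    (Lp.stronglyMeasurable _).measurable.enorm.pow_const r
  have hWmono : ∀ x, Monotone fun K => W K x := fun x => by
    refine monotone_nat_of_le_succ fun K => iSup_le fun n => ?_
    have hn : 2 * (n : ℕ) < 4 ^ (K + 1) + 1 := by
      have := n.2
      rw [pow_succ]; omega
    have e : ((n : ℕ) : ℝ) / 2 ^ K = ((2 * n : ℕ) : ℝ) / 2 ^ (K + 1) := by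
      rw [pow_succ]; push_cast; field_simp
    simp only [hW]
    rw [e]
    exact le_iSup (fun n : Fin (4 ^ (K + 1) + 1) => ‖P (n / 2 ^ (K + 1)) f x‖ₑ ^ r) ⟨2 * n, hn⟩
  refine ⟨fun x => ⨆ K, W K x, Measurable.iSup hWm, fun t ht => ?_, ?_⟩
  · set s : ℕ → ℝ := fun K => (⌊t * 2 ^ K⌋₊ : ℝ) / 2 ^ K with hs
    have hs_lim : Tendsto s atTop (𝓝 t) := by
      have h1 := tendsto_nat_floor_mul_div_atTop ht.le
      exact h1.comp (tendsto_pow_atTop_atTop_of_one_lt (one_lt_two (α := ℝ)))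
    have hs0 : ∀ K, s K ∈ Ici (0 : ℝ) := fun K => by
      rw [mem_Ici]; positivity
    have hPlim : Tendsto (fun K => P (s K) f) atTop (𝓝 (P t f)) :=
      (hP.continuousOn f t (mem_Ici.2 ht.le)).tendsto.comp
        (tendsto_nhdsWithin_iff.2 ⟨hs_lim, Eventually.of_forall hs0⟩)
    obtain ⟨ns, hns, hae⟩ := (tendstoInMeasure_of_tendsto_Lp hPlim).exists_seq_tendsto_ae
    filter_upwards [hae] with x hx
    have h1 : Tendsto (fun k => ‖P (s (ns k)) f x‖ₑ ^ r) atTop (𝓝 (‖P t f x‖ₑ ^ r)) :=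
      (hx.enorm).ennrpow_const r
    refine le_of_tendsto h1 ?_
    have hev : ∀ᶠ K : ℕ in atTop, t ≤ 2 ^ K :=
      (tendsto_pow_atTop_atTop_of_one_lt (one_lt_two (α := ℝ))).eventually_ge_atTop t
    filter_upwards [hns.tendsto_atTop.eventually hev] with k hk
    have hlt : ⌊t * 2 ^ ns k⌋₊ < 4 ^ ns k + 1 := by
      refine Nat.lt_succ_iff.2 (Nat.floor_le_of_le ?_)
      push_cast
      rw [show (4 : ℝ) = 2 * 2 by norm_num, mul_pow]
      gcongr
    exact (le_iSup (fun n : Fin (4 ^ ns k + 1) => ‖P (n / 2 ^ ns k) f x‖ₑ ^ r)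
      ⟨_, hlt⟩).trans (le_iSup (fun K => W K x) (ns k))
  · rw [lintegral_iSup hWm fun i j hij x => hWmono x hij]
    refine iSup_le fun K => ?_
    -- Halving the mesh makes every time of the grid an even multiple of `δ`, as the inequality for
    -- even powers requires.
    have hδ : (0 : ℝ) ≤ 1 / 2 ^ (K + 1) := by positivity
    have h := (hP.isSubMarkov hδ).lintegral_iSup_le (hP.symm _ hδ) (hP.contraction _ hδ) hr f (4 ^ K)
    refine le_trans (le_of_eq ?_) h
    refine lintegral_congr fun x => iSup_congr fun n => ?_
    rw [hP.iterate hδ]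
    congr 5
    rw [pow_succ]; push_cast; field_simp

/-- Read off from the maximal function; the sharp constant one is not needed for the extension to
`L^p`. -/
theorem DirichletForm.IsSemigroup.lintegral_rpow_le (hP : 𝓔.IsSemigroup P) {r : ℝ} (hr : 1 < r)
    (f : Lp ℝ 2 m) {t : ℝ} (ht : 0 < t) :
    ∫⁻ x, ‖P t f x‖ₑ ^ r ∂m ≤
      ENNReal.ofReal (2 ^ r / (r - 1)) * ∫⁻ x, ‖f x‖ₑ ^ r ∂m := by
  obtain ⟨w, -, hw, hle⟩ := hP.exists_maximal hr f
  exact (lintegral_mono_ae (hw t ht)).trans hle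

end Maximal

/-! ### Extension to `L^p` and jointly measurable versions -/

section Versions

variable {E : Type*} [MeasurableSpace E] {m : Measure E} {𝓔 : DirichletForm m}
  {P : ℝ → Lp ℝ 2 m →L[ℝ] Lp ℝ 2 m}

theorem DirichletForm.IsSemigroup.exists_measurable_version (hP : 𝓔.IsSemigroup P)
    (f : Lp ℝ 2 m) : ∃ u : ℝ → E → ℝ, Measurable (fun z : ℝ × E => u z.1 z.2) ∧
      ∀ t > 0, u t =ᵐ[m] P t f := by
  classical
  set F : ℝ → Lp ℝ 2 m := fun t => P (max t 0) f with hF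
  have hFc : Continuous F := (hP.continuousOn f).comp_continuous (by fun_prop)
    fun t => mem_Ici.2 (le_max_right _ _)
  set q : ℕ → ℝ := TopologicalSpace.denseSeq ℝ with hq
  have hex : ∀ (j : ℕ) (t : ℝ), ∃ i, ‖F (q i) - F t‖ < (1 / 2) ^ j := fun j t => by
    have ho : IsOpen {s | ‖F s - F t‖ < (1 / 2) ^ j} := isOpen_lt (by fun_prop) continuous_const
    obtain ⟨_, h, ⟨i, rfl⟩⟩ := (TopologicalSpace.denseRange_denseSeq ℝ).inter_open_nonempty _ ho
      ⟨t, by simp⟩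
    exact ⟨i, h⟩
  -- The first index of a dense sequence of times approximating `F t` within `2⁻ʲ` depends
  -- measurably on `t`. Freezing time there leaves countably many representatives, and the rate
  -- gives convergence almost everywhere for each `t`.
  set N : ℕ → ℝ → ℕ := fun j t => Nat.find (hex j t) with hN
  have hNm : ∀ j, Measurable (N j) := fun j => measurable_find (hex j) fun i =>
    (isOpen_lt (by fun_prop) continuous_const).measurableSet
  have hNs : ∀ j t, ‖F (q (N j t)) - F t‖ < (1 / 2) ^ j := fun j t => Nat.find_spec (hex j t)
  have hrep : Measurable fun z : ℕ × E => F (q z.1) z.2 :=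
    measurable_from_prod_countable_right fun i => (Lp.stronglyMeasurable (F (q i))).measurable
  refine ⟨fun t x => limsup (fun j => F (q (N j t)) x) atTop, ?_, fun t ht => ?_⟩
  · exact Measurable.limsup fun j =>
      hrep.comp (((hNm j).comp measurable_fst).prodMk measurable_snd)
  · have h := ae_tendsto_of_norm_sub_le (g := fun j => F (q (N j t))) (f := F t) (C := 1)
      fun j => by rw [one_mul]; exact (hNs j t).le
    filter_upwards [h] with x hx
    rw [hx.limsup_eq]
    simp only [hF, max_eq_left (le_of_lt (show (0 : ℝ) < t from ht))]

theorem lintegral_rpow_eq_eLpNorm {p : ℝ≥0∞} (h0 : p ≠ 0) (ht : p ≠ ∞) (g : E → ℝ) :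
    ∫⁻ x, ‖g x‖ₑ ^ p.toReal ∂m = eLpNorm g p m ^ p.toReal := by
  have hr : p.toReal ≠ 0 := (ENNReal.toReal_pos h0 ht).ne'
  rw [eLpNorm_eq_lintegral_rpow_enorm_toReal h0 ht, ← ENNReal.rpow_mul, one_div_mul_cancel hr,
    ENNReal.rpow_one]

/-- A bound for the norm of the semigroup on `L^p`. -/
noncomputable def semigroupBound (p : ℝ≥0∞) : ℝ≥0∞ :=
  ENNReal.ofReal (2 ^ p.toReal / (p.toReal - 1)) ^ (1 / p.toReal)

theorem semigroupBound_ne_top (p : ℝ≥0∞) : semigroupBound p ≠ ∞ :=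
  ENNReal.rpow_ne_top_of_nonneg (by positivity) ENNReal.ofReal_ne_top

variable {p : ℝ≥0∞}

theorem DirichletForm.IsSemigroup.eLpNorm_sub_le (hP : 𝓔.IsSemigroup P) (hp : 1 < p) (hpt : p ≠ ∞)
    (f g : Lp ℝ 2 m) {t : ℝ} (ht : 0 < t) :
    eLpNorm (fun x => P t f x - P t g x) p m ≤
      semigroupBound p * eLpNorm (fun x => f x - g x) p m := by
  have hp0 : p ≠ 0 := (zero_lt_one.trans hp).ne'
  have hr : 1 < p.toReal := by
    rw [← ENNReal.toReal_one]; exact (ENNReal.toReal_lt_toReal ENNReal.one_ne_top hpt).2 hp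
  have hr0 : 0 < p.toReal := by linarith
  have h := hP.lintegral_rpow_le hr (f - g) ht
  rw [lintegral_rpow_eq_eLpNorm hp0 hpt, lintegral_rpow_eq_eLpNorm hp0 hpt] at h
  have e1 : eLpNorm (P t (f - g)) p m = eLpNorm (fun x => P t f x - P t g x) p m := by
    rw [map_sub]; exact eLpNorm_congr_ae (Lp.coeFn_sub _ _)
  have e2 : eLpNorm (f - g : Lp ℝ 2 m) p m = eLpNorm (fun x => f x - g x) p m :=
    eLpNorm_congr_ae (Lp.coeFn_sub _ _)
  rw [e1, e2] at h
  have h' := ENNReal.rpow_le_rpow h (z := 1 / p.toReal) (by positivity)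
  rwa [ENNReal.mul_rpow_of_nonneg _ _ (by positivity), ← ENNReal.rpow_mul, ← ENNReal.rpow_mul,
    mul_one_div_cancel hr0.ne', ENNReal.rpow_one, ENNReal.rpow_one] at h'

theorem DirichletForm.IsSemigroup.memLp (hP : 𝓔.IsSemigroup P) (hp : 1 < p) (hpt : p ≠ ∞)
    {f : Lp ℝ 2 m} (hf : MemLp f p m) {t : ℝ} (ht : 0 < t) : MemLp (P t f) p m := by
  refine ⟨Lp.aestronglyMeasurable _, ?_⟩
  have h := hP.eLpNorm_sub_le hp hpt f 0 ht
  have e1 : eLpNorm (fun x => P t f x - P t 0 x) p m = eLpNorm (P t f) p m := by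
    refine eLpNorm_congr_ae ?_
    rw [map_zero]
    filter_upwards [Lp.coeFn_zero ℝ 2 m] with x hx
    rw [hx]; simp
  have e2 : eLpNorm (fun x => f x - (0 : Lp ℝ 2 m) x) p m = eLpNorm f p m := by
    refine eLpNorm_congr_ae ?_
    filter_upwards [Lp.coeFn_zero ℝ 2 m] with x hx
    rw [hx]; simp
  rw [e1, e2] at h
  exact h.trans_lt (ENNReal.mul_lt_top (semigroupBound_ne_top p).lt_top hf.2)

/-- Simple functions in `L^p` also lie in `L²`. The geometric rate makes convergence almost
everywhere available along the whole sequence. -/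
theorem exists_approx (hp : 1 < p) (hpt : p ≠ ∞) {f : E → ℝ} (hf : MemLp f p m) :
    ∃ h : ℕ → Lp ℝ 2 m, (∀ n, MemLp (h n) p m) ∧
      ∀ n, eLpNorm (fun x => h n x - f x) p m ≤ (1 / 2) ^ n := by
  have hp0 : p ≠ 0 := (zero_lt_one.trans hp).ne'
  have hex : ∀ n : ℕ, ∃ h : Lp ℝ 2 m, MemLp h p m ∧
      eLpNorm (fun x => h x - f x) p m ≤ (1 / 2) ^ n := by
    intro n
    obtain ⟨g, hg, hgp⟩ := hf.exists_simpleFunc_eLpNorm_sub_lt hpt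
      (ε := (1 / 2) ^ n) (by simp)
    have hg2 : MemLp g 2 m := (SimpleFunc.memLp_iff two_ne_zero ENNReal.ofNat_ne_top).2
      ((SimpleFunc.memLp_iff hp0 hpt).1 hgp)
    refine ⟨hg2.toLp g, hgp.ae_eq hg2.coeFn_toLp.symm, ?_⟩
    refine le_trans (le_of_eq ?_) hg.le
    rw [← eLpNorm_neg]
    refine eLpNorm_congr_ae ?_
    filter_upwards [hg2.coeFn_toLp] with x hx
    simp [hx]
  choose h h1 h2 using hex
  exact ⟨h, h1, h2⟩

theorem tendsto_half_pow : Tendsto (fun n : ℕ => ((1 / 2 : ℝ≥0∞)) ^ n) atTop (𝓝 0) :=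
  ENNReal.tendsto_pow_atTop_nhds_zero_of_lt_one (by simp)

theorem ae_tendsto_of_eLpNorm_le (hp : 1 < p) (hpt : p ≠ ∞) {g : ℕ → E → ℝ} {f : E → ℝ}
    (hg : ∀ k, AEStronglyMeasurable (g k) m) (hf : AEStronglyMeasurable f m) {C : ℝ≥0∞}
    (hC : C ≠ ∞) (h : ∀ k, eLpNorm (fun x => g k x - f x) p m ≤ C * (1 / 2) ^ k) :
    ∀ᵐ x ∂m, Tendsto (fun k => g k x) atTop (𝓝 (f x)) := by
  have hp0 : p ≠ 0 := (zero_lt_one.trans hp).ne'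
  have hr0 : 0 < p.toReal := ENNReal.toReal_pos hp0 hpt
  refine ae_tendsto_of_tsum_lintegral_ne_top hr0 hg hf ?_
  have h1 : ∀ k, ∫⁻ x, ‖g k x - f x‖ₑ ^ p.toReal ∂m ≤
      C ^ p.toReal * ((1 / 2) ^ p.toReal) ^ k := fun k => by
    rw [lintegral_rpow_eq_eLpNorm hp0 hpt (fun x => g k x - f x)]
    refine (ENNReal.rpow_le_rpow (h k) hr0.le).trans (le_of_eq ?_)
    rw [ENNReal.mul_rpow_of_nonneg _ _ hr0.le, ← ENNReal.rpow_natCast, ← ENNReal.rpow_natCast,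
      ← ENNReal.rpow_mul, ← ENNReal.rpow_mul, mul_comm p.toReal]
  refine ne_top_of_le_ne_top ?_ (ENNReal.tsum_le_tsum h1)
  rw [ENNReal.tsum_mul_left, ENNReal.tsum_geometric]
  refine ENNReal.mul_ne_top (ENNReal.rpow_ne_top_of_nonneg hr0.le hC) (ENNReal.inv_ne_top.2 ?_)
  refine (tsub_pos_of_lt ?_).ne'
  exact ENNReal.rpow_lt_one (by simp) hr0

/-- The extension of the semigroup to `L^p` is bounded. -/
theorem IsLpExtension.eLpNorm_sub_le (hP : 𝓔.IsSemigroup P) (hp : 1 < p) (hpt : p ≠ ∞)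
    {f g : E → ℝ} (hf : MemLp f p m) {t : ℝ} (ht : 0 < t) (hg : IsLpExtension (P t) p f g)
    (h : Lp ℝ 2 m) :
    eLpNorm (fun x => P t h x - g x) p m ≤
      semigroupBound p * eLpNorm (fun x => h x - f x) p m := by
  obtain ⟨k, hk, hkf⟩ := exists_approx hp hpt hf
  have hk0 : Tendsto (fun n => eLpNorm (fun x => k n x - f x) p m) atTop (𝓝 0) :=
    tendsto_of_tendsto_of_tendsto_of_le_of_le tendsto_const_nhds tendsto_half_pow
      (fun _ => zero_le) hkf
  have hk1 := hg.2 k hk hk0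
  have hle : ∀ n, eLpNorm (fun x => P t h x - g x) p m ≤
      semigroupBound p * (eLpNorm (fun x => h x - f x) p m + eLpNorm (fun x => k n x - f x) p m)
        + eLpNorm (fun x => P t (k n) x - g x) p m := by
    intro n
    have e1 : (fun x => P t h x - g x) = (fun x => P t h x - P t (k n) x) +
        fun x => P t (k n) x - g x := by ext x; simp
    have e2 : (fun x => h x - k n x) = (fun x => h x - f x) - fun x => k n x - f x := by
      ext x; simp
    rw [e1]
    refine (eLpNorm_add_le ((Lp.aestronglyMeasurable _).sub (Lp.aestronglyMeasurable _))
      ((Lp.aestronglyMeasurable _).sub hg.1.1) hp.le).trans (add_le_add_left ?_ _)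
    refine (hP.eLpNorm_sub_le hp hpt h (k n) ht).trans ?_
    rw [e2]
    gcongr
    exact MeasureTheory.eLpNorm_sub_le ((Lp.aestronglyMeasurable _).sub hf.1)
      ((Lp.aestronglyMeasurable _).sub hf.1) hp.le
  have hlim : Tendsto (fun n => semigroupBound p * (eLpNorm (fun x => h x - f x) p m +
      eLpNorm (fun x => k n x - f x) p m) + eLpNorm (fun x => P t (k n) x - g x) p m) atTop
      (𝓝 (semigroupBound p * (eLpNorm (fun x => h x - f x) p m + 0) + 0)) :=
    (ENNReal.Tendsto.const_mul (tendsto_const_nhds.add hk0) (Or.inr (semigroupBound_ne_top p))).add hk1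
  simpa using ge_of_tendsto' hlim hle

theorem DirichletForm.IsSemigroup.ae_exists_tendsto (hP : 𝓔.IsSemigroup P) (hp : 1 < p)
    (hpt : p ≠ ∞) {f : E → ℝ} (hf : MemLp f p m) {h : ℕ → Lp ℝ 2 m}
    (hhf : ∀ n, eLpNorm (fun x => h n x - f x) p m ≤ (1 / 2) ^ n) {t : ℝ} (ht : 0 < t) :
    ∀ᵐ x ∂m, ∃ l, Tendsto (fun n => P t (h n) x) atTop (𝓝 l) := by
  have hBt : semigroupBound p + 1 ≠ ∞ :=
    ENNReal.add_ne_top.2 ⟨semigroupBound_ne_top p, ENNReal.one_ne_top⟩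
  have hpow : ∀ N n : ℕ, N ≤ n → (1 / 2 : ℝ≥0∞) ^ n ≤ (1 / 2) ^ N := fun N n hn =>
    pow_le_pow_right_of_le_one' (by simp) hn
  have hcau : ∀ N n k : ℕ, N ≤ n → N ≤ k → eLpNorm (⇑(P t (h n)) - ⇑(P t (h k))) p m <
      (semigroupBound p + 1) * (2 * (1 / 2) ^ N) + (1 / 2) ^ N := by
    intro N n k hn hk
    have e : (fun x => h n x - h k x) = (fun x => h n x - f x) - fun x => h k x - f x := by
      ext x; simp
    have h1 : eLpNorm (fun x => h n x - h k x) p m ≤ 2 * (1 / 2) ^ N := by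
      rw [e, two_mul]
      exact (MeasureTheory.eLpNorm_sub_le ((Lp.aestronglyMeasurable _).sub hf.1)
        ((Lp.aestronglyMeasurable _).sub hf.1) hp.le).trans
        (add_le_add ((hhf n).trans (hpow N n hn)) ((hhf k).trans (hpow N k hk)))
    have h2 : eLpNorm (fun x => P t (h n) x - P t (h k) x) p m ≤
        (semigroupBound p + 1) * (2 * (1 / 2) ^ N) :=
      (hP.eLpNorm_sub_le hp hpt (h n) (h k) ht).trans (mul_le_mul' le_self_add h1)
    refine lt_of_le_of_lt h2 (ENNReal.lt_add_right ?_ ?_)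
    · exact ENNReal.mul_ne_top hBt
        (ENNReal.mul_ne_top ENNReal.ofNat_ne_top (ENNReal.pow_ne_top (by simp)))
    · exact pow_ne_zero _ (by simp)
  have hB : ∑' N : ℕ, ((semigroupBound p + 1) * (2 * (1 / 2) ^ N) + (1 / 2 : ℝ≥0∞) ^ N) ≠ ∞ := by
    have hgeo : ∑' N : ℕ, (1 / 2 : ℝ≥0∞) ^ N ≠ ∞ := by
      rw [ENNReal.tsum_geometric]; simp
    rw [ENNReal.tsum_add, ENNReal.tsum_mul_left, ENNReal.tsum_mul_left]
    exact ENNReal.add_ne_top.2 ⟨ENNReal.mul_ne_top hBt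
      (ENNReal.mul_ne_top ENNReal.ofNat_ne_top hgeo), hgeo⟩
  exact Lp.ae_tendsto_of_cauchy_eLpNorm (fun _ => Lp.aestronglyMeasurable _) hp.le hB hcau

theorem exists_isSemigroupVersion (hP : 𝓔.IsSemigroup P) (hp : 1 < p) (hpt : p ≠ ∞)
    {f : E → ℝ} (hf : MemLp f p m) : ∃ u, IsSemigroupVersion P p f u := by
  obtain ⟨h, hhp, hhf⟩ := exists_approx hp hpt hf
  obtain ⟨u, hum, hu⟩ : ∃ u : ℝ → E → ℝ, Measurable (fun z : ℝ × E => u z.1 z.2) ∧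
      ∀ t > 0, ∀ᵐ x ∂m, Tendsto (fun n => P t (h n) x) atTop (𝓝 (u t x)) := by
    choose v hvm hv using fun n => hP.exists_measurable_version (h n)
    refine ⟨fun t x => limsup (fun n => v n t x) atTop, Measurable.limsup hvm, fun t ht => ?_⟩
    filter_upwards [hP.ae_exists_tendsto hp hpt hf hhf ht, ae_all_iff.2 fun n => hv n t ht]
      with x ⟨l, hl⟩ hx
    simp only [hx]
    rwa [hl.limsup_eq]
  refine ⟨u, hum, fun t ht => ?_⟩
  have hgm : Measurable (u t) := hum.comp (measurable_prodMk_left (x := t))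
  have hlim := hu t ht
  generalize u t = g at hgm hlim ⊢
  -- Fatou along `h n` bounds the candidate limit against every `k`, not only the chosen sequence;
  -- this gives the independence of the approximation in `IsLpExtension`.
  have key : ∀ k : Lp ℝ 2 m, eLpNorm (fun x => P t k x - g x) p m ≤
      semigroupBound p * eLpNorm (fun x => k x - f x) p m := by
    intro k
    have h1 : eLpNorm (fun x => P t k x - g x) p m ≤
        liminf (fun n => eLpNorm (fun x => P t k x - P t (h n) x) p m) atTop :=
      Lp.eLpNorm_lim_le_liminf_eLpNorm
        (fun n => (Lp.aestronglyMeasurable _).sub (Lp.aestronglyMeasurable _)) _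
        (hlim.mono fun x hx => hx.const_sub _)
    have h2 : ∀ n, eLpNorm (fun x => P t k x - P t (h n) x) p m ≤
        semigroupBound p * (eLpNorm (fun x => k x - f x) p m + (1 / 2) ^ n) := fun n => by
      refine (hP.eLpNorm_sub_le hp hpt k (h n) ht).trans ?_
      have e : (fun x => k x - h n x) = (fun x => k x - f x) - fun x => h n x - f x := by
        ext x; simp
      rw [e]
      gcongr
      exact (MeasureTheory.eLpNorm_sub_le ((Lp.aestronglyMeasurable _).sub hf.1)
        ((Lp.aestronglyMeasurable _).sub hf.1) hp.le).trans (add_le_add_right (hhf n) _)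
    have h3 : Tendsto (fun n : ℕ => semigroupBound p *
        (eLpNorm (fun x => k x - f x) p m + (1 / 2) ^ n)) atTop
        (𝓝 (semigroupBound p * (eLpNorm (fun x => k x - f x) p m + 0))) :=
      ENNReal.Tendsto.const_mul (tendsto_const_nhds.add tendsto_half_pow)
        (Or.inr (semigroupBound_ne_top p))
    rw [add_zero] at h3
    rw [← h3.liminf_eq]
    exact h1.trans (liminf_le_liminf (Eventually.of_forall h2))
  refine ⟨?_, fun k hk hk0 => ?_⟩
  · have h1 : MemLp (fun x => P t (h 0) x - g x) p m :=
      ⟨(Lp.aestronglyMeasurable _).sub hgm.aestronglyMeasurable, (key (h 0)).trans_lt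
        (ENNReal.mul_lt_top (semigroupBound_ne_top p).lt_top ((hhp 0).sub hf).2)⟩
    have h2 := (hP.memLp hp hpt (hhp 0) ht).sub h1
    have e : (⇑(P t (h 0)) - fun x => P t (h 0) x - g x) = g := by ext x; simp
    rwa [e] at h2
  · have h3 := ENNReal.Tendsto.const_mul hk0 (Or.inr (semigroupBound_ne_top p))
    rw [mul_zero] at h3
    exact tendsto_of_tendsto_of_tendsto_of_le_of_le tendsto_const_nhds h3
      (fun _ => zero_le) fun n => key (k n)

theorem lintegral_rpow_approx_le (hp : 1 < p) (hpt : p ≠ ∞) {f : E → ℝ} (hf : MemLp f p m)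
    {h : ℕ → Lp ℝ 2 m} (hhf : ∀ n, eLpNorm (fun x => h n x - f x) p m ≤ (1 / 2) ^ n)
    (C : ℝ≥0∞) (hC : C ≠ ∞) :
    liminf (fun n => C * ∫⁻ x, ‖h n x‖ₑ ^ p.toReal ∂m) atTop ≤
      C * ∫⁻ x, ‖f x‖ₑ ^ p.toReal ∂m := by
  have hp0 : p ≠ 0 := (zero_lt_one.trans hp).ne'
  have h1 : ∀ n, C * ∫⁻ x, ‖h n x‖ₑ ^ p.toReal ∂m ≤
      C * (eLpNorm f p m + (1 / 2) ^ n) ^ p.toReal := fun n => by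
    rw [lintegral_rpow_eq_eLpNorm hp0 hpt]
    have e : ⇑(h n) = f + fun x => h n x - f x := by ext x; simp
    gcongr
    rw [e]
    exact (eLpNorm_add_le hf.1 ((Lp.aestronglyMeasurable _).sub hf.1) hp.le).trans
      (add_le_add_right (hhf n) _)
  have h2 : Tendsto (fun n : ℕ => C * (eLpNorm f p m + (1 / 2) ^ n) ^ p.toReal) atTop
      (𝓝 (C * (eLpNorm f p m + 0) ^ p.toReal)) :=
    ENNReal.Tendsto.const_mul ((tendsto_const_nhds.add tendsto_half_pow).ennrpow_const _)
      (Or.inr hC)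
  rw [lintegral_rpow_eq_eLpNorm hp0 hpt f, ← add_zero (eLpNorm f p m), ← h2.liminf_eq]
  exact liminf_le_liminf (Eventually.of_forall h1)

theorem IsSemigroupVersion.ae_tendsto (hP : 𝓔.IsSemigroup P) (hp : 1 < p) (hpt : p ≠ ∞)
    {f : E → ℝ} (hf : MemLp f p m) {u : ℝ → E → ℝ} (hu : IsSemigroupVersion P p f u)
    {h : ℕ → Lp ℝ 2 m} (hhf : ∀ n, eLpNorm (fun x => h n x - f x) p m ≤ (1 / 2) ^ n)
    {t : ℝ} (ht : 0 < t) : ∀ᵐ x ∂m, Tendsto (fun n => P t (h n) x) atTop (𝓝 (u t x)) :=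
  ae_tendsto_of_eLpNorm_le hp hpt (fun _ => Lp.aestronglyMeasurable _) (hu.2 t ht).1.1
    (semigroupBound_ne_top p) fun n =>
      ((hu.2 t ht).eLpNorm_sub_le hP hp hpt hf ht (h n)).trans (mul_le_mul_right (hhf n) _)

/-- The maximal theorem on `L^p`. -/
theorem IsSemigroupVersion.exists_maximal (hP : 𝓔.IsSemigroup P) (hp : 1 < p) (hpt : p ≠ ∞)
    {f : E → ℝ} (hf : MemLp f p m) {u : ℝ → E → ℝ} (hu : IsSemigroupVersion P p f u) :
    ∃ w : E → ℝ≥0∞, Measurable w ∧ (∀ t > 0, ∀ᵐ x ∂m, ‖u t x‖ₑ ^ p.toReal ≤ w x) ∧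
      ∫⁻ x, w x ∂m ≤ ENNReal.ofReal (2 ^ p.toReal / (p.toReal - 1)) *
        ∫⁻ x, ‖f x‖ₑ ^ p.toReal ∂m := by
  have hr : 1 < p.toReal := by
    rw [← ENNReal.toReal_one]; exact (ENNReal.toReal_lt_toReal ENNReal.one_ne_top hpt).2 hp
  obtain ⟨h, -, hhf⟩ := exists_approx hp hpt hf
  choose w hwm hw hwle using fun n => hP.exists_maximal hr (h n)
  refine ⟨fun x => liminf (fun n => w n x) atTop, Measurable.liminf hwm, fun t ht => ?_, ?_⟩
  · filter_upwards [hu.ae_tendsto hP hp hpt hf hhf ht, ae_all_iff.2 fun n => hw n t ht] with x h1 h2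
    have h3 : Tendsto (fun n => ‖P t (h n) x‖ₑ ^ p.toReal) atTop (𝓝 (‖u t x‖ₑ ^ p.toReal)) :=
      (h1.enorm).ennrpow_const _
    rw [← h3.liminf_eq]
    exact liminf_le_liminf (Eventually.of_forall h2)
  · refine (lintegral_liminf_le hwm).trans ((liminf_le_liminf (Eventually.of_forall hwle)).trans ?_)
    exact lintegral_rpow_approx_le hp hpt hf hhf _ ENNReal.ofReal_ne_top

end Versions

/-- A monotone function is differentiable almost everywhere, and the integral of `-g'` is at most
the total decrease of `g`: a singular part would only help. So absolute continuity in time is never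
needed. -/
theorem lintegral_le_of_antitoneOn {g : ℝ → ℝ} (hg : AntitoneOn g (Ici 0))
    (h0 : ∀ t ≥ 0, 0 ≤ g t) {D : ℝ → ℝ≥0∞}
    (hD : ∀ t > 0, DifferentiableAt ℝ g t → D t ≤ ENNReal.ofReal (-deriv g t)) :
    ∫⁻ t in Ioi (0 : ℝ), D t ≤ ENNReal.ofReal (g 0) := by
  have hdiff : ∀ᵐ t : ℝ, t ∈ Ioi (0 : ℝ) → DifferentiableAt ℝ g t := by
    have h1 : MonotoneOn (-g) (Ioi 0) := hg.neg.mono Ioi_subset_Ici_self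
    filter_upwards [h1.ae_differentiableWithinAt_of_mem] with t ht htm
    have h2 := (ht htm).neg
    rw [neg_neg] at h2
    exact h2.differentiableAt (Ioi_mem_nhds htm)
  have hneg : ∀ t ∈ Ioi (0 : ℝ), 0 ≤ -deriv g t := fun t ht => by
    rw [← derivWithin_of_mem_nhds (Ici_mem_nhds ht)]
    exact neg_nonneg.2 hg.derivWithin_nonpos
  have hn : ∀ n : ℕ, ∫⁻ t in Ioc (0 : ℝ) n, D t ≤ ENNReal.ofReal (g 0) := fun n => by
    have hn0 : (0 : ℝ) ≤ n := Nat.cast_nonneg n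
    have hmono : MonotoneOn (-g) (uIcc 0 (n : ℝ)) := by
      rw [uIcc_of_le hn0]; exact hg.neg.mono Icc_subset_Ici_self
    have hd : deriv (-g) = fun t => -deriv g t := by ext t; rw [deriv.neg]
    have hint := hmono.intervalIntegrable_deriv
    have hle := hmono.intervalIntegral_deriv_mem_uIcc
    rw [hd] at hint hle
    have hanti : g n ≤ g 0 := hg (mem_Ici.2 le_rfl) (mem_Ici.2 hn0) hn0
    rw [uIcc_of_le (by simp only [Pi.neg_apply]; linarith)] at hle
    have h1 := h0 n hn0
    have h2 := hle.2
    simp only [Pi.neg_apply] at h2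
    rw [intervalIntegral.integral_of_le hn0] at h2
    calc ∫⁻ t in Ioc (0 : ℝ) n, D t ≤ ∫⁻ t in Ioc (0 : ℝ) n, ENNReal.ofReal (-deriv g t) := by
          refine lintegral_mono_ae ?_
          filter_upwards [ae_restrict_of_ae hdiff, ae_restrict_mem measurableSet_Ioc] with t ht htm
          exact hD t htm.1 (ht htm.1)
      _ = ENNReal.ofReal (∫ t in Ioc (0 : ℝ) n, -deriv g t) := by
          rw [ofReal_integral_eq_lintegral_ofReal
            ((intervalIntegrable_iff_integrableOn_Ioc_of_le hn0).1 hint)]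
          filter_upwards [ae_restrict_mem measurableSet_Ioc] with t ht using hneg t ht.1
      _ ≤ ENNReal.ofReal (g 0) := ENNReal.ofReal_le_ofReal (by linarith)
  have hU : Ioi (0 : ℝ) = ⋃ n : ℕ, Ioc (0 : ℝ) n := by
    ext t
    simp only [mem_Ioi, mem_iUnion, mem_Ioc]
    exact ⟨fun h => (exists_nat_ge t).imp fun n hn => ⟨h, hn⟩, fun ⟨n, hn⟩ => hn.1⟩
  rw [hU, setLIntegral_iUnion_of_directed]
  · exact iSup_le hn
  · exact Monotone.directed_le fun i j hij => Ioc_subset_Ioc_right (by exact_mod_cast hij)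

/-! ### Jump energy and the square function -/

section Jump

variable {E : Type*} [MeasurableSpace E] {m : Measure E} {𝓔 : DirichletForm m} {J : Kernel E E}

/-- The jumping measure `J (x, dy) m (dx)` off the diagonal. -/
noncomputable def jumpMeasure (m : Measure E) (J : Kernel E E) : Measure (E × E) :=
  (m ⊗ₘ J).restrict (diagonal E)ᶜ

theorem ae_jumpMeasure_fst [SFinite m] [IsSFiniteKernel J] {q : E → Prop} (h : ∀ᵐ x ∂m, q x) :
    ∀ᵐ z ∂jumpMeasure m J, q z.1 := by
  refine ae_restrict_of_ae ?_
  obtain ⟨s, hs, hsm, hs0⟩ := exists_measurable_superset_of_null h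
  have h1 : ∀ᵐ x ∂m, x ∈ sᶜ := compl_mem_ae_iff.2 hs0
  filter_upwards [Measure.ae_compProd_of_ae_fst J hsm.compl h1] with z hz
  by_contra hcon
  exact hz (hs hcon)

/-- The first marginal ignores `m`-null sets by construction of the jumping measure, and its
symmetry transfers this to the second. Versions may thus be exchanged in both variables. -/
theorem DirichletForm.IsPureJump.ae_snd [SFinite m] [IsSFiniteKernel J] (hJ : 𝓔.IsPureJump J)
    {q : E → Prop} (h : ∀ᵐ x ∂m, q x) : ∀ᵐ z ∂jumpMeasure m J, q z.2 := by
  have h1 := ae_jumpMeasure_fst (J := J) h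
  rw [show jumpMeasure m J = (jumpMeasure m J).map Prod.swap from hJ.symm.symm] at h1
  exact ae_of_ae_map measurable_swap.aemeasurable h1

/-- Monotonicity of `ψ` makes the integrand non-negative, so the form can be computed as a Lebesgue
integral in `[0, ∞]`. -/
theorem DirichletForm.IsPureJump.form_grad [SFinite m] [IsSFiniteKernel J] (hJ : 𝓔.IsPureJump J)
    {φ ψ : ℝ → ℝ} {L : ℝ≥0} (h : IsConvexPotential φ ψ L) (u : 𝓔.domain)
    (hu : h.grad (u : Lp ℝ 2 m) ∈ 𝓔.domain) :
    0 ≤ 𝓔.form u ⟨_, hu⟩ ∧ ENNReal.ofReal (𝓔.form u ⟨_, hu⟩) =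
      ENNReal.ofReal (1 / 2) * ∫⁻ z, ENNReal.ofReal (((u : Lp ℝ 2 m) z.2 - (u : Lp ℝ 2 m) z.1) *
        (ψ ((u : Lp ℝ 2 m) z.2) - ψ ((u : Lp ℝ 2 m) z.1))) ∂jumpMeasure m J := by
  have hform : 𝓔.form u ⟨_, hu⟩ = 1 / 2 * ∫ z, ((u : Lp ℝ 2 m) z.2 - (u : Lp ℝ 2 m) z.1) *
      (h.grad (u : Lp ℝ 2 m) z.2 - h.grad (u : Lp ℝ 2 m) z.1) ∂jumpMeasure m J :=
    hJ.form_eq u ⟨_, hu⟩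
  have hint : Integrable (fun z => ((u : Lp ℝ 2 m) z.2 - (u : Lp ℝ 2 m) z.1) *
      (h.grad (u : Lp ℝ 2 m) z.2 - h.grad (u : Lp ℝ 2 m) z.1)) (jumpMeasure m J) :=
    hJ.integrable u ⟨_, hu⟩
  have hae : (fun z : E × E => ((u : Lp ℝ 2 m) z.2 - (u : Lp ℝ 2 m) z.1) *
      (h.grad (u : Lp ℝ 2 m) z.2 - h.grad (u : Lp ℝ 2 m) z.1)) =ᵐ[jumpMeasure m J]
      fun z => ((u : Lp ℝ 2 m) z.2 - (u : Lp ℝ 2 m) z.1) *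
        (ψ ((u : Lp ℝ 2 m) z.2) - ψ ((u : Lp ℝ 2 m) z.1)) := by
    filter_upwards [ae_jumpMeasure_fst (h.coeFn_grad (u : Lp ℝ 2 m)),
      hJ.ae_snd (h.coeFn_grad (u : Lp ℝ 2 m))] with z h1 h2
    rw [h1, h2]
  rw [integral_congr_ae hae] at hform
  have hint' := hint.congr hae
  have hnn : ∀ z : E × E, 0 ≤ ((u : Lp ℝ 2 m) z.2 - (u : Lp ℝ 2 m) z.1) *
      (ψ ((u : Lp ℝ 2 m) z.2) - ψ ((u : Lp ℝ 2 m) z.1)) := fun z => h.mul_nonneg _ _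
  rw [hform]
  refine ⟨mul_nonneg (by norm_num) (integral_nonneg hnn), ?_⟩
  rw [ENNReal.ofReal_mul (by norm_num), ofReal_integral_eq_lintegral_ofReal hint'
    (Eventually.of_forall hnn)]

theorem measurable_powDensity_version {u : ℝ → E → ℝ}
    (hu : Measurable fun z : ℝ × E => u z.1 z.2) (r ε : ℝ) :
    Measurable fun z : ℝ × E × E =>
      ENNReal.ofReal (powDensity r ε (u z.1 z.2.1) (u z.1 z.2.2)) := by
  have h1 : Measurable fun z : ℝ × E × E => u z.1 z.2.1 :=
    hu.comp (measurable_fst.prodMk (measurable_fst.comp measurable_snd))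
  have h2 : Measurable fun z : ℝ × E × E => u z.1 z.2.2 :=
    hu.comp (measurable_fst.prodMk (measurable_snd.comp measurable_snd))
  exact ((measurable_powDensity r ε).comp (h1.prodMk h2)).ennreal_ofReal

variable {P : ℝ → Lp ℝ 2 m →L[ℝ] Lp ℝ 2 m}

theorem DirichletForm.IsPureJump.lintegral_powDensity_le [SFinite m] [IsSFiniteKernel J]
    (hJ : 𝓔.IsPureJump J) (hP : 𝓔.IsSemigroup P) {r ε : ℝ} (hr : 1 < r) (hr2 : r ≤ 2)
    (hε : 0 < ε) (f : Lp ℝ 2 m) {u : ℝ → E → ℝ} (hu : ∀ t > 0, u t =ᵐ[m] P t f) :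
    ∫⁻ t in Ioi (0 : ℝ), ∫⁻ z, ENNReal.ofReal (powDensity r ε (u t z.1) (u t z.2))
        ∂jumpMeasure m J ≤
      ENNReal.ofReal (2 / (r * (r - 1))) * ∫⁻ x, ‖f x‖ₑ ^ r ∂m := by
  have h := isConvexPotential_pow hr hr2 hε
  have hc : 0 < r * (r - 1) := mul_pos (by linarith) (by linarith)
  have hanti := hP.integral_potential_antitone h f fun v =>
    ⟨hP.grad_mem_domain h v, (hJ.form_grad h v (hP.grad_mem_domain h v)).1⟩
  set D : ℝ → ℝ≥0∞ := fun t =>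
    ∫⁻ z, ENNReal.ofReal (powDensity r ε (u t z.1) (u t z.2)) ∂jumpMeasure m J with hDdef
  have hD : ∀ t > 0, DifferentiableAt ℝ (fun t => ∫ x, powPotential r ε (P t f x) ∂m) t →
      ENNReal.ofReal (r * (r - 1) / 2) * D t ≤
        ENNReal.ofReal (-deriv (fun t => ∫ x, powPotential r ε (P t f x) ∂m) t) := by
    intro t ht hdiff
    set v : 𝓔.domain := ⟨P t f, hP.apply_mem_domain f ht⟩ with hv
    have hgm := hP.grad_mem_domain h v
    obtain ⟨B, hB, hBlim⟩ := hP.exists_slope_le h f ht hgm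
    have hsub : Ioi t ⊆ {t}ᶜ := fun z hz => (mem_Ioi.1 hz).ne'
    have hslope := hdiff.hasDerivAt.tendsto_slope.mono_left (nhdsWithin_mono t hsub)
    -- Where the derivative exists it is the limit of the right slopes, so the slope bound becomes a
    -- bound by minus the form.
    have hle := le_of_tendsto_of_tendsto hslope hBlim hB
    have hform := (hJ.form_grad h v hgm).2
    refine le_trans ?_ (ENNReal.ofReal_le_ofReal (show 𝓔.form v ⟨_, hgm⟩ ≤ _ by linarith))
    rw [hform, show r * (r - 1) / 2 = 1 / 2 * (r * (r - 1)) by ring,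
      ENNReal.ofReal_mul (by norm_num), mul_assoc,
      ← lintegral_const_mul' _ _ ENNReal.ofReal_ne_top]
    gcongr ENNReal.ofReal (1 / 2) * ?_
    refine lintegral_mono_ae ?_
    filter_upwards [ae_jumpMeasure_fst (hu t ht), hJ.ae_snd (hu t ht)] with z h1 h2
    rw [h1, h2, ← ENNReal.ofReal_mul hc.le]
    exact ENNReal.ofReal_le_ofReal (powDensity_le hr hr2 hε _ _)
  have hint := lintegral_le_of_antitoneOn hanti
    (fun t _ => integral_nonneg fun x => h.nonneg _) hD
  have h0 : ENNReal.ofReal (∫ x, powPotential r ε (P 0 f x) ∂m) ≤ ∫⁻ x, ‖f x‖ₑ ^ r ∂m := by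
    rw [hP.zero, ofReal_integral_eq_lintegral_ofReal (h.integrable f)
      (Eventually.of_forall fun x => h.nonneg _)]
    refine lintegral_mono fun x => ?_
    rw [Real.enorm_eq_ofReal_abs, ENNReal.ofReal_rpow_of_nonneg (abs_nonneg _) (by linarith)]
    exact ENNReal.ofReal_le_ofReal (powPotential_le hr hr2 _)
  rw [lintegral_const_mul' _ _ ENNReal.ofReal_ne_top] at hint
  have h1 := mul_le_mul_right (hint.trans h0) (ENNReal.ofReal (2 / (r * (r - 1))))
  have hc' := hc.ne'
  rw [← mul_assoc, ← ENNReal.ofReal_mul (by positivity),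
    show 2 / (r * (r - 1)) * (r * (r - 1) / 2) = 1 by rw [div_mul_div_cancel₀ hc', div_self two_ne_zero],
    ENNReal.ofReal_one, one_mul] at h1
  exact h1

variable {p : ℝ≥0∞}

/-- Fatou is applied twice, over jumps and over times, with the regularization and the `L²`
approximation removed simultaneously; the constant does not depend on `ε`. -/
theorem IsSemigroupVersion.lintegral_powDensity_le [SFinite m] [IsSFiniteKernel J]
    (hJ : 𝓔.IsPureJump J) (hP : 𝓔.IsSemigroup P) (hp : 1 < p) (hp2 : p ≤ 2) {f : E → ℝ}
    (hf : MemLp f p m) {u : ℝ → E → ℝ} (hu : IsSemigroupVersion P p f u) :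
    ∫⁻ t in Ioi (0 : ℝ), ∫⁻ z, ENNReal.ofReal (powDensity p.toReal 0 (u t z.1) (u t z.2))
        ∂jumpMeasure m J ≤
      ENNReal.ofReal (2 / (p.toReal * (p.toReal - 1))) * ∫⁻ x, ‖f x‖ₑ ^ p.toReal ∂m := by
  have hpt : p ≠ ∞ := (hp2.trans_lt ENNReal.ofNat_lt_top).ne
  have hr : 1 < p.toReal := by
    rw [← ENNReal.toReal_one]; exact (ENNReal.toReal_lt_toReal ENNReal.one_ne_top hpt).2 hp
  have hr2 : p.toReal ≤ 2 := by
    rw [← ENNReal.toReal_ofNat]; exact ENNReal.toReal_mono ENNReal.ofNat_ne_top hp2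
  obtain ⟨h, -, hhf⟩ := exists_approx hp hpt hf
  choose v hvm hv using fun n => hP.exists_measurable_version (h n)
  have : SFinite (jumpMeasure m J) := by unfold jumpMeasure; infer_instance
  set ε : ℕ → ℝ := fun n => 1 / (n + 1) with hε
  have hε0 : Tendsto ε atTop (𝓝 0) := tendsto_one_div_add_atTop_nhds_zero_nat
  have hm : ∀ n, Measurable fun z : ℝ × E × E =>
      ENNReal.ofReal (powDensity p.toReal (ε n) (v n z.1 z.2.1) (v n z.1 z.2.2)) := fun n =>
    measurable_powDensity_version (hvm n) _ _
  calc ∫⁻ t in Ioi (0 : ℝ), ∫⁻ z, ENNReal.ofReal (powDensity p.toReal 0 (u t z.1) (u t z.2))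
        ∂jumpMeasure m J
      ≤ ∫⁻ t in Ioi (0 : ℝ), liminf (fun n => ∫⁻ z, ENNReal.ofReal
          (powDensity p.toReal (ε n) (v n t z.1) (v n t z.2)) ∂jumpMeasure m J) atTop := by
        refine setLIntegral_mono' measurableSet_Ioi fun t ht => ?_
        have hlim : ∀ᵐ x ∂m, Tendsto (fun n => v n t x) atTop (𝓝 (u t x)) := by
          filter_upwards [hu.ae_tendsto hP hp hpt hf hhf ht, ae_all_iff.2 fun n => hv n t ht]
            with x h1 h2
          simpa only [h2] using h1
        refine le_trans (lintegral_mono_ae ?_) (lintegral_liminf_le fun n =>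
          (hm n).comp (measurable_prodMk_left (x := t)))
        filter_upwards [ae_jumpMeasure_fst hlim, hJ.ae_snd hlim] with z h1 h2
        exact powDensity_le_liminf hε0 h1 h2
    _ ≤ liminf (fun n => ∫⁻ t in Ioi (0 : ℝ), ∫⁻ z, ENNReal.ofReal
          (powDensity p.toReal (ε n) (v n t z.1) (v n t z.2)) ∂jumpMeasure m J) atTop :=
        lintegral_liminf_le fun n => (hm n).lintegral_prod_right'
    _ ≤ liminf (fun n => ENNReal.ofReal (2 / (p.toReal * (p.toReal - 1))) *
          ∫⁻ x, ‖h n x‖ₑ ^ p.toReal ∂m) atTop :=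
        liminf_le_liminf (Eventually.of_forall fun n =>
          hJ.lintegral_powDensity_le hP hr hr2 (by positivity) (h n) (hv n))
    _ ≤ _ := lintegral_rpow_approx_le hp hpt hf hhf _ ENNReal.ofReal_ne_top

theorem lintegral_jumpMeasure [SFinite m] [IsSFiniteKernel J] [MeasurableEq E]
    {F : E × E → ℝ≥0∞} (hF : Measurable F) :
    ∫⁻ z, F z ∂jumpMeasure m J = ∫⁻ x, ∫⁻ y in {x}ᶜ, F (x, y) ∂J x ∂m := by
  have hd : MeasurableSet (diagonal E)ᶜ := measurableSet_diagonal.compl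
  rw [jumpMeasure, ← lintegral_indicator hd, Measure.lintegral_compProd (hF.indicator hd)]
  refine lintegral_congr fun x => ?_
  rw [← lintegral_indicator (measurableSet_singleton x).compl]
  refine lintegral_congr fun y => ?_
  by_cases hxy : x = y
  · subst hxy; simp
  · rw [indicator_of_mem (by simpa using hxy), indicator_of_mem (by simpa using Ne.symm hxy)]

theorem measurable_lintegral_compl_singleton [IsSFiniteKernel J] [MeasurableEq E]
    {F : ℝ × E × E → ℝ≥0∞} (hF : Measurable F) :
    Measurable fun z : ℝ × E => ∫⁻ y in {z.2}ᶜ, F (z.1, z.2, y) ∂J z.2 := by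
  have hind : ∀ z : ℝ × E, ∫⁻ y in {z.2}ᶜ, F (z.1, z.2, y) ∂J z.2 =
      ∫⁻ y, ({z : ℝ × E × E | z.2 ∈ (diagonal E)ᶜ}.indicator F) (z.1, z.2, y) ∂J z.2 := fun z => by
    rw [← lintegral_indicator (measurableSet_singleton z.2).compl]
    refine lintegral_congr fun y => ?_
    by_cases hxy : z.2 = y
    · rw [indicator_of_notMem (by simpa using hxy.symm), indicator_of_notMem (by simpa using hxy)]
    · rw [indicator_of_mem (by simpa using Ne.symm hxy), indicator_of_mem (by simpa using hxy)]
  simp only [hind]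
  have hset : MeasurableSet {z : ℝ × E × E | z.2 ∈ (diagonal E)ᶜ} :=
    measurableSet_diagonal.compl.preimage measurable_snd
  have hm : Measurable fun z : (ℝ × E) × E =>
      ({z : ℝ × E × E | z.2 ∈ (diagonal E)ᶜ}.indicator F) (z.1.1, z.1.2, z.2) :=
    (hF.indicator hset).comp (by fun_prop)
  exact Measurable.lintegral_kernel_prod_right (κ := J.comap Prod.snd measurable_snd) hm

theorem lintegral_lintegral_jumpMeasure [SFinite m] [IsSFiniteKernel J] [MeasurableEq E]
    {F : ℝ × E × E → ℝ≥0∞} (hF : Measurable F) (ν : Measure ℝ) [SFinite ν] :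
    ∫⁻ x, ∫⁻ t, ∫⁻ y in {x}ᶜ, F (t, x, y) ∂J x ∂ν ∂m = ∫⁻ t, ∫⁻ z, F (t, z) ∂jumpMeasure m J ∂ν := by
  have hm : Measurable (Function.uncurry fun (x : E) (t : ℝ) => ∫⁻ y in {x}ᶜ, F (t, x, y) ∂J x) :=
    (measurable_lintegral_compl_singleton (J := J) hF).comp measurable_swap
  rw [lintegral_lintegral_swap hm.aemeasurable]
  exact lintegral_congr fun t =>
    (lintegral_jumpMeasure (hF.comp (measurable_prodMk_left (x := t)))).symm

/-- The factor `|u t x| ^ (2 - r)` is bounded by `c ^ ((2 - r) / r)` and leaves the time integral;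
the power `r / 2` then turns its exponent into `(2 - r) / 2`. -/
theorem modifiedSquareFunction_rpow_le [IsSFiniteKernel J] [MeasurableEq E] {u : ℝ → E → ℝ}
    (hu : Measurable fun z : ℝ × E => u z.1 z.2) {r : ℝ} (hr : 0 < r) (hr2 : r ≤ 2) {x : E}
    {c : ℝ≥0∞} (hc : ∀ᵐ t ∂volume.restrict (Ioi (0 : ℝ)), ‖u t x‖ₑ ^ r ≤ c) :
    modifiedSquareFunction J u x ^ r ≤ c ^ ((2 - r) / 2) * (∫⁻ t in Ioi (0 : ℝ), ∫⁻ y in {x}ᶜ,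
      ENNReal.ofReal (powDensity r 0 (u t x) (u t y)) ∂J x) ^ (r / 2) := by
  have hFm := measurable_powDensity_version hu r 0
  have hmt : Measurable fun t : ℝ => ∫⁻ y in {x}ᶜ,
      ENNReal.ofReal (powDensity r 0 (u t x) (u t y)) ∂J x :=
    (measurable_lintegral_compl_singleton (J := J) hFm).comp (measurable_prodMk_right (y := x))
  have h1 : ∫⁻ t in Ioi (0 : ℝ), modifiedCarreDuChamp J (u t) x ≤
      c ^ ((2 - r) / r) * ∫⁻ t in Ioi (0 : ℝ), ∫⁻ y in {x}ᶜ,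
        ENNReal.ofReal (powDensity r 0 (u t x) (u t y)) ∂J x := by
    rw [← lintegral_const_mul _ hmt]
    refine lintegral_mono_ae ?_
    filter_upwards [hc] with t ht
    have hmy : Measurable fun y => ENNReal.ofReal (powDensity r 0 (u t x) (u t y)) :=
      hFm.comp (measurable_const.prodMk (measurable_const.prodMk measurable_id) :
        Measurable fun y : E => (t, x, y))
    rw [modifiedCarreDuChamp, ← lintegral_const_mul _ hmy]
    refine lintegral_mono fun y => (sq_mul_chi_le (r := r) _ _).trans ?_
    refine mul_le_mul_left ?_ _
    have h2 := ENNReal.rpow_le_rpow ht (z := (2 - r) / r) (div_nonneg (by linarith) hr.le)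
    rwa [← ENNReal.rpow_mul, mul_div_cancel₀ _ hr.ne', Real.enorm_eq_ofReal_abs] at h2
  rw [modifiedSquareFunction, ← ENNReal.rpow_mul, one_div_mul_eq_div]
  refine (ENNReal.rpow_le_rpow h1 (by positivity)).trans (le_of_eq ?_)
  rw [ENNReal.mul_rpow_of_nonneg _ _ (by positivity), ← ENNReal.rpow_mul]
  congr 2
  field_simp

/-- The constant in the square function estimate. -/
noncomputable def squareFunctionConst (r : ℝ) : ℝ := 2 ^ r / (r - 1) + 2 / (r * (r - 1))

/-- Hölder with weights `(2 - r) / 2` and `r / 2` combines the maximal theorem with the energy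
estimate. The sum of their constants dominates both, and the weights add up to one, so this sum is
the final constant. -/
theorem IsSemigroupVersion.lintegral_modifiedSquareFunction_le [SFinite m] [IsSFiniteKernel J]
    [MeasurableEq E] (hJ : 𝓔.IsPureJump J) (hP : 𝓔.IsSemigroup P) (hp : 1 < p)
    (hp2 : p ≤ 2) {f : E → ℝ} (hf : MemLp f p m) {u : ℝ → E → ℝ}
    (hu : IsSemigroupVersion P p f u) :
    ∫⁻ x, modifiedSquareFunction J u x ^ p.toReal ∂m ≤
      ENNReal.ofReal (squareFunctionConst p.toReal) * ∫⁻ x, ‖f x‖ₑ ^ p.toReal ∂m := by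
  have hpt : p ≠ ∞ := (hp2.trans_lt ENNReal.ofNat_lt_top).ne
  have hr : 1 < p.toReal := by
    rw [← ENNReal.toReal_one]; exact (ENNReal.toReal_lt_toReal ENNReal.one_ne_top hpt).2 hp
  have hr2 : p.toReal ≤ 2 := by
    rw [← ENNReal.toReal_ofNat]; exact ENNReal.toReal_mono ENNReal.ofNat_ne_top hp2
  obtain ⟨w, hwm, hw, hwle⟩ := hu.exists_maximal hP hp hpt hf
  have henergy := hu.lintegral_powDensity_le hJ hP hp hp2 hf
  have hum := hu.1
  generalize p.toReal = r at *
  have hr0 : 0 < r := by linarith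
  have hr1 : 0 < r - 1 := by linarith
  have hFm := measurable_powDensity_version hum r 0
  rw [← lintegral_lintegral_jumpMeasure hFm] at henergy
  have hIm : Measurable fun x => ∫⁻ t in Ioi (0 : ℝ), ∫⁻ y in {x}ᶜ,
      ENNReal.ofReal (powDensity r 0 (u t x) (u t y)) ∂J x :=
    ((measurable_lintegral_compl_singleton (J := J) hFm).comp measurable_swap).lintegral_prod_right'
  -- The exceptional set in the maximal theorem depends on `t`. Joint measurability lets Fubini
  -- exchange the quantifiers: for almost every `x` the bound holds for almost every `t`.
  have hwae : ∀ᵐ x ∂m, ∀ᵐ t ∂volume.restrict (Ioi (0 : ℝ)), ‖u t x‖ₑ ^ r ≤ w x := by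
    have hset : MeasurableSet {z : E × ℝ | ‖u z.2 z.1‖ₑ ^ r ≤ w z.1} :=
      measurableSet_le (((hum.comp measurable_swap).enorm).pow_const r) (hwm.comp measurable_fst)
    rw [Measure.ae_ae_comm hset]
    filter_upwards [ae_restrict_mem measurableSet_Ioi] with t ht using hw t ht
  have hc1 : 0 ≤ (2 - r) / 2 := by linarith
  have hc2 : 0 ≤ r / 2 := by linarith
  have hpos1 : 0 ≤ 2 ^ r / (r - 1) := by positivity
  have hpos2 : 0 ≤ 2 / (r * (r - 1)) := by positivity
  generalize (∫⁻ x, ‖f x‖ₑ ^ r ∂m) = A at *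
  have hC : ∀ a, a ≤ squareFunctionConst r →
      ENNReal.ofReal a * A ≤ ENNReal.ofReal (squareFunctionConst r) * A := fun a ha => by
    gcongr
  calc ∫⁻ x, modifiedSquareFunction J u x ^ r ∂m
      ≤ ∫⁻ x, w x ^ ((2 - r) / 2) * (∫⁻ t in Ioi (0 : ℝ), ∫⁻ y in {x}ᶜ,
          ENNReal.ofReal (powDensity r 0 (u t x) (u t y)) ∂J x) ^ (r / 2) ∂m :=
        lintegral_mono_ae (hwae.mono fun x hx => modifiedSquareFunction_rpow_le hum hr0 hr2 hx)
    _ ≤ (∫⁻ x, w x ∂m) ^ ((2 - r) / 2) * (∫⁻ x, (∫⁻ t in Ioi (0 : ℝ), ∫⁻ y in {x}ᶜ,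
          ENNReal.ofReal (powDensity r 0 (u t x) (u t y)) ∂J x) ∂m) ^ (r / 2) :=
        ENNReal.lintegral_mul_norm_pow_le hwm.aemeasurable hIm.aemeasurable hc1 hc2 (by ring)
    _ ≤ (ENNReal.ofReal (squareFunctionConst r) * A) ^ ((2 - r) / 2) *
          (ENNReal.ofReal (squareFunctionConst r) * A) ^ (r / 2) := by
        refine mul_le_mul' (ENNReal.rpow_le_rpow (hwle.trans (hC _ ?_)) hc1)
          (ENNReal.rpow_le_rpow (henergy.trans (hC _ ?_)) hc2) <;>
        unfold squareFunctionConst <;> linarith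
    _ = _ := by
        rw [← ENNReal.rpow_add_of_nonneg _ _ hc1 hc2, show (2 - r) / 2 + r / 2 = 1 by ring,
          ENNReal.rpow_one]

end Jump

theorem theorem4p1 (p : ℝ≥0∞) (hp1 : 1 < p) (hp2 : p ≤ 2) :
    ∃ C : ℝ≥0, 0 < C ∧
      ∀ (E : Type*) [MetricSpace E] [LocallyCompactSpace E] [TopologicalSpace.SeparableSpace E]
        [MeasurableSpace E] [BorelSpace E]
        (m : Measure E) [IsFiniteMeasureOnCompacts m] [m.IsOpenPosMeasure]
        (𝓔 : DirichletForm m) (J : Kernel E E) [IsSFiniteKernel J]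
        (P : ℝ → Lp ℝ 2 m →L[ℝ] Lp ℝ 2 m),
        𝓔.IsRegular → 𝓔.IsPureJump J → 𝓔.IsSemigroup P →
        ∀ f : E → ℝ, MemLp f p m →
          (∃ u : ℝ → E → ℝ, IsSemigroupVersion P p f u) ∧
          ∀ u : ℝ → E → ℝ, IsSemigroupVersion P p f u →
            eLpNorm (modifiedSquareFunction J u) p m ≤ C * eLpNorm f p m := by
  have hpt : p ≠ ∞ := (hp2.trans_lt ENNReal.ofNat_lt_top).ne
  have hp0 : p ≠ 0 := (zero_lt_one.trans hp1).ne'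
  have hr : 1 < p.toReal := by
    rw [← ENNReal.toReal_one]; exact (ENNReal.toReal_lt_toReal ENNReal.one_ne_top hpt).2 hp1
  have hr0 : 0 < p.toReal := by linarith
  have hr1 : 0 < p.toReal - 1 := by linarith
  have hK : 0 < squareFunctionConst p.toReal := by unfold squareFunctionConst; positivity
  refine ⟨Real.toNNReal (squareFunctionConst p.toReal) ^ (1 / p.toReal),
    NNReal.rpow_pos (Real.toNNReal_pos.2 hK), ?_⟩
  intro E _ _ _ _ _ m _ _ 𝓔 J _ P _ hJ hP f hf
  -- Second countability makes the diagonal measurable and, with local compactness, `m` σ-finite.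
  have : SecondCountableTopology E := UniformSpace.secondCountable_of_separable E
  refine ⟨exists_isSemigroupVersion hP hp1 hpt hf, fun u hu => ?_⟩
  have h := hu.lintegral_modifiedSquareFunction_le hJ hP hp1 hp2 hf
  rw [lintegral_rpow_eq_eLpNorm hp0 hpt f] at h
  rw [eLpNorm_eq_lintegral_rpow_enorm_toReal hp0 hpt]
  simp only [enorm_eq_self]
  refine (ENNReal.rpow_le_rpow h (z := 1 / p.toReal) (by positivity)).trans (le_of_eq ?_)
  rw [ENNReal.mul_rpow_of_nonneg _ _ (by positivity), ← ENNReal.rpow_mul,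
    mul_one_div_cancel hr0.ne', ENNReal.rpow_one, ENNReal.coe_rpow_of_nonneg _ (by positivity)]
  rfl
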